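/- For $N\in\mathbb N=\{1,2,\dots\}$ and $1\le p\le\infty$ let $l_p^N$ be $\mathbb R^N$ with the norm $\|x\|_{l_p^N}=\bigl(\sum_{i=1}^N|x_i|^p\bigr)^{1/p}$ ($\max_i|x_i|$ if $p=\infty$), and let $B_p^N$ be its closed unit ball; let $p'$ be given by $\frac1p+\frac1{p'}=1$. For a normed space $X$, a nonempty set $M\subset X$ and an integer $n\ge 0$ the Gelfand $n$-width of $M$ in $X$ is $$d^n(M,X)=\inf_{x_1^*,\dots,x_n^*\in X^*}\ \sup\Bigl\{\|x\|:\ x\in M\cap\bigcap_{j=1}^n\ker x_j^*\Bigr\}.$$ Theorem. For every $p_1\in(1,2)$ there are constants $c,C>0$ depending only on $p_1$ such that the following holds. Let $2\le q\le\infty$, let $r\ge1$, let $p_1\le p_2\le\dots\le p_r\le q$, let $N\in\mathbb N$, let $n\ge 0$ be an integer with $n\le N/2$, and let $\nu_1,\dots,\nu_r>0$ satisfy $$\nu_1\ge\nu_2\ge\dots\ge\nu_r,\qquad \nu_1N^{-1/p_1}\le\nu_2N^{-1/p_2}\le\dots\le\nu_rN^{-1/p_r}$$ (with $1/\infty=0$).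 Then $$c\,\min\{\nu_1n^{-1/2}N^{1/p_1'},\,\nu_r\}\ \le\ d^n\Bigl(\bigcap_{j=1}^r\nu_jB_{p_j}^N,\ l_q^N\Bigr)\ \le\ C\,\min\{\nu_1n^{-1/2}N^{1/p_1'},\,\nu_r\},$$ where for $n=0$ we put $n^{-1/2}=+\infty$, so that the minimum equals $\nu_r$. -/

import Mathlib

open scoped ENNReal Pointwise

/-- The Gelfand `n`-width `d^n(M, X)` of a set `M` in a real normed space `X`: the infimum over all
`n`-tuples of continuous linear functionals of the supremum of the norm on the part of `M` on which
they all vanish. Values are taken in `[0, ∞]`, so neither the infimum nor the supremum has a junk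
value. -/
noncomputable def gelfandWidth {X : Type*} [NormedAddCommGroup X] [NormedSpace ℝ X]
    (n : ℕ) (M : Set X) : ℝ≥0∞ :=
  ⨅ f : Fin n → StrongDual ℝ X, ⨆ x ∈ M ∩ {x : X | ∀ i, f i x = 0}, ‖x‖ₑ

/-- The closed unit ball `B_p^N` of `l_p^N`, as a subset of `ℝ^N`. -/
def lpUnitBall (N : ℕ) (p : ℝ≥0∞) : Set (Fin N → ℝ) :=
  {x | ‖(WithLp.toLp p x : PiLp p fun _ : Fin N => ℝ)‖ ≤ 1}

/-- The intersection of the balls `ν_j B_{p_j}^N`, viewed as a subset of the normed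
space `l_q^N` (that is, `PiLp q fun _ : Fin N => ℝ`). -/
def ballsInter {ι : Type*} (N : ℕ) (q : ℝ≥0∞) (p : ι → ℝ≥0∞) (ν : ι → ℝ) :
    Set (PiLp q fun _ : Fin N => ℝ) :=
  {x | WithLp.ofLp x ∈ ⋂ j, ν j • lpUnitBall N (p j)}

/-- `min {ν₁ n^{-1/2} N^{1/p₁'}, ν_r}`, where `p₁'` is the exponent conjugate to `p₁`. It is computed
in `[0, ∞]`, where `n^{-1/2} = ∞` for `n = 0`, so that the minimum is then `ν_r`. -/
noncomputable def widthRate (n N : ℕ) (p₁ : ℝ≥0∞) (ν₁ νr : ℝ) : ℝ≥0∞ :=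
  min (ENNReal.ofReal ν₁ * (n : ℝ≥0∞) ^ (-(1 / 2) : ℝ)
      * (N : ℝ≥0∞) ^ (1 / ENNReal.conjExponent p₁).toReal)
    (ENNReal.ofReal νr)

/-!
Upper bound: with positive probability a Gaussian map from `ℝ^N` to `ℝ^n` multiplies the norms of
all integer vectors by about `√n`, up to an error governed by the logarithm of the number of integer
vectors of the same `l_1`-norm (a union bound). A kernel vector from the `l_p`-ball is rounded to
grids of mesh `a / 2^j`. Consecutive roundings differ by a multiple of a `{-1, 0, 1}`-vector, so the
images of these differences are controlled and telescope; the resulting series are geometric because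
`1 < p < 2`. This bounds the image of the coarsest rounding. Its mesh is chosen so that the map is
bounded below there, which bounds the rounding and hence the vector itself.

Lower bound: the trace of the projection onto a subspace of codimension at most `N / 2` is at least
`N / 2`, so some coordinate vector `e` keeps a projection with a coordinate at least `1 / 2`; this
projection has all `l_p`-norms under control since it is close to `e` in `l_2`.
-/

section Gaussian

open MeasureTheory ProbabilityTheory
open scoped NNReal RealInnerProductSpace

theorem integral_exp_neg_mul_sq_gaussianReal (v : ℝ≥0) {a : ℝ} (ha : 0 < 1 + 2 * a * v) :
    ∫ x, Real.exp (-a * x ^ 2) ∂gaussianReal 0 v = (√(1 + 2 * a * v))⁻¹ := by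
  rcases eq_or_ne v 0 with rfl | hv
  · simp
  have hv0 : (0 : ℝ) < v := by positivity
  rw [integral_gaussianReal_eq_integral_smul hv]
  have hdensity : ∀ x : ℝ, gaussianPDFReal 0 v x • Real.exp (-a * x ^ 2) =
      (√(2 * Real.pi * v))⁻¹ * Real.exp (-((1 + 2 * a * v) / (2 * v)) * x ^ 2) := by
    intro x
    rw [gaussianPDFReal, smul_eq_mul, mul_assoc, ← Real.exp_add]
    congr 2
    field_simp
    ring
  simp_rw [hdensity]
  rw [integral_const_mul, integral_gaussian, ← Real.sqrt_inv, ← Real.sqrt_inv,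
    ← Real.sqrt_mul (by positivity)]
  congr 1
  field_simp

section GaussianMap

variable {κ E : Type*} [Fintype κ] [NormedAddCommGroup E] [InnerProductSpace ℝ E]

/-- The linear map whose matrix has the rows `G k`. With independent standard Gaussian rows it is
the random operator whose kernel realizes the upper bound for the Gelfand width. -/
noncomputable def rowMap (G : κ → E) : E →ₗ[ℝ] EuclideanSpace ℝ κ :=
  (WithLp.linearEquiv 2 ℝ (κ → ℝ)).symm.toLinearMap ∘ₗ
    LinearMap.pi fun k => (innerSL ℝ (G k)).toLinearMap

theorem norm_rowMap_sq (G : κ → E) (z : E) : ‖rowMap G z‖ ^ 2 = ∑ k, ⟪G k, z⟫ ^ 2 := by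
  simp [rowMap, EuclideanSpace.norm_sq_eq]

/-- An exponential of the ratio `‖rowMap G z‖² / ‖z‖²`, normalized so that its mean over independent
standard Gaussian rows `G k` is one; `a > 0` controls the lower tail of the ratio and `a < 0` the
upper one. -/
noncomputable def expNormRatio (a : ℝ) (z : E) (G : κ → E) : ℝ :=
  √(1 + 2 * a) ^ Fintype.card κ * Real.exp (-a * (‖rowMap G z‖ ^ 2 / ‖z‖ ^ 2))

theorem expNormRatio_nonneg (a : ℝ) (z : E) (G : κ → E) : 0 ≤ expNormRatio a z G := by
  unfold expNormRatio; positivity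

theorem sub_le_of_expNormRatio_le_exp {a w : ℝ} {z : E} {G : κ → E} (ha : 0 < 1 + 2 * a)
    (h : expNormRatio a z G ≤ Real.exp w) :
    Fintype.card κ / 2 * Real.log (1 + 2 * a) - a * (‖rowMap G z‖ ^ 2 / ‖z‖ ^ 2) ≤ w := by
  have hpos := Real.sqrt_pos.2 ha
  have hlog := Real.log_le_log (by unfold expNormRatio; positivity) h
  rw [expNormRatio, Real.log_mul (by positivity) (Real.exp_pos _).ne', Real.log_exp, Real.log_exp,
    Real.log_pow, Real.log_sqrt ha.le] at hlog
  linarith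

variable [FiniteDimensional ℝ E] [MeasurableSpace E] [BorelSpace E]

theorem map_inner_stdGaussian (z : E) :
    (stdGaussian E).map (fun g => ⟪g, z⟫) = gaussianReal 0 (‖z‖₊ ^ 2) := by
  have h := IsGaussian.map_eq_gaussianReal (μ := stdGaussian E) (innerSL ℝ z)
  rw [variance_dual_stdGaussian, integral_strongDual_stdGaussian, innerSL_apply_norm] at h
  have hv : Real.toNNReal (‖z‖ ^ 2) = ‖z‖₊ ^ 2 := by ext; simp
  rw [← hv, ← h]
  congr 1
  ext g
  exact real_inner_comm _ _

theorem integral_exp_neg_mul_inner_sq_stdGaussian (z : E) {a : ℝ} (ha : 0 < 1 + 2 * a * ‖z‖ ^ 2) :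
    ∫ g, Real.exp (-a * ⟪g, z⟫ ^ 2) ∂stdGaussian E = (√(1 + 2 * a * ‖z‖ ^ 2))⁻¹ := by
  have h := integral_exp_neg_mul_sq_gaussianReal (‖z‖₊ ^ 2) (a := a) (by simpa using ha)
  rw [← map_inner_stdGaussian, integral_map (by fun_prop) (by fun_prop)] at h
  simpa using h

theorem integral_exp_neg_mul_norm_rowMap_sq (z : E) {a : ℝ} (ha : 0 < 1 + 2 * a * ‖z‖ ^ 2) :
    ∫ G, Real.exp (-a * ‖rowMap G z‖ ^ 2) ∂Measure.pi (fun _ : κ => stdGaussian E) =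
      (√(1 + 2 * a * ‖z‖ ^ 2))⁻¹ ^ Fintype.card κ := by
  simp_rw [norm_rowMap_sq, Finset.mul_sum, Real.exp_sum]
  rw [integral_fintype_prod_eq_pow (fun g : E => Real.exp (-a * ⟪g, z⟫ ^ 2)),
    integral_exp_neg_mul_inner_sq_stdGaussian z ha]

theorem integral_expNormRatio {z : E} (hz : z ≠ 0) {a : ℝ} (ha : 0 < 1 + 2 * a) :
    ∫ G, expNormRatio a z G ∂Measure.pi (fun _ : κ => stdGaussian E) = 1 := by
  have hz2 : ‖z‖ ^ 2 ≠ 0 := by positivity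
  have h := integral_exp_neg_mul_norm_rowMap_sq (κ := κ) z (a := a / ‖z‖ ^ 2)
    (by rwa [mul_assoc, div_mul_cancel₀ _ hz2])
  have hexp : ∀ G : κ → E, -a * (‖rowMap G z‖ ^ 2 / ‖z‖ ^ 2) =
      -(a / ‖z‖ ^ 2) * ‖rowMap G z‖ ^ 2 := fun G => by ring
  simp_rw [expNormRatio, hexp]
  rw [integral_const_mul, h, mul_assoc, div_mul_cancel₀ _ hz2, ← mul_pow,
    mul_inv_cancel₀ (Real.sqrt_pos.2 ha).ne', one_pow]

theorem integrable_expNormRatio {z : E} (hz : z ≠ 0) {a : ℝ} (ha : 0 < 1 + 2 * a) :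
    Integrable (expNormRatio a z) (Measure.pi fun _ : κ => stdGaussian E) :=
  Integrable.of_integral_ne_zero (by rw [integral_expNormRatio hz ha]; exact one_ne_zero)

end GaussianMap

theorem exists_forall_le_exp_of_sum_integral_le {Ω ι : Type*} [MeasurableSpace Ω] {μ : Measure Ω}
    [IsProbabilityMeasure μ] {T : Finset ι} {X : ι → Ω → ℝ} {w : ι → ℝ}
    (hX : ∀ i ∈ T, Integrable (X i) μ) (hX0 : ∀ i ω, 0 ≤ X i ω)
    (hw : ∑ i ∈ T, Real.exp (-w i) * ∫ ω, X i ω ∂μ ≤ 1) :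
    ∃ ω, ∀ i ∈ T, X i ω ≤ Real.exp (w i) := by
  obtain ⟨ω, hω⟩ := exists_le_integral
    (integrable_finsetSum T fun i hi => (hX i hi).const_mul (Real.exp (-w i)))
  rw [integral_finsetSum _ fun i hi => (hX i hi).const_mul _] at hω
  simp only [integral_const_mul] at hω
  refine ⟨ω, fun i hi => ?_⟩
  have hterm : Real.exp (-w i) * X i ω ≤ 1 :=
    (Finset.single_le_sum (f := fun i => Real.exp (-w i) * X i ω)
      (fun i _ => mul_nonneg (Real.exp_pos _).le (hX0 i ω)) hi).trans (hω.trans hw)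
  rwa [Real.exp_neg, inv_mul_le_iff₀ (Real.exp_pos _), mul_one] at hterm

section ExistsLinearMap

variable {κ E α : Type*} [Fintype κ] [NormedAddCommGroup E] [InnerProductSpace ℝ E]
  [FiniteDimensional ℝ E] {T : Finset α} {v : α → E} {w : α → ℝ}

theorem exists_forall_expNormRatio_le_exp (hv : ∀ i ∈ T, v i ≠ 0)
    (hw : ∑ i ∈ T, Real.exp (-w i) ≤ 1 / 2) {a b : ℝ} (ha : 0 < 1 + 2 * a) (hb : 0 < 1 + 2 * b) :
    ∃ G : κ → E, ∀ i ∈ T,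
      expNormRatio a (v i) G ≤ Real.exp (w i) ∧ expNormRatio b (v i) G ≤ Real.exp (w i) := by
  borelize E
  have hmean : ∀ i ∈ T, ∫ G, (expNormRatio a (v i) G + expNormRatio b (v i) G)
      ∂Measure.pi (fun _ : κ => stdGaussian E) = 2 := fun i hi => by
    rw [integral_add (integrable_expNormRatio (hv i hi) ha)
      (integrable_expNormRatio (hv i hi) hb), integral_expNormRatio (hv i hi) ha,
      integral_expNormRatio (hv i hi) hb, one_add_one_eq_two]
  obtain ⟨G, hG⟩ := exists_forall_le_exp_of_sum_integral_le
    (fun i hi => (integrable_expNormRatio (hv i hi) ha).add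
      (integrable_expNormRatio (hv i hi) hb))
    (fun i G => add_nonneg (expNormRatio_nonneg a (v i) G) (expNormRatio_nonneg b (v i) G))
    (w := w) (by
      calc _ = ∑ i ∈ T, Real.exp (-w i) * 2 :=
            Finset.sum_congr rfl fun i hi => by rw [← hmean i hi]; rfl
        _ ≤ 1 := by rw [← Finset.sum_mul]; linarith)
  exact ⟨G, fun i hi =>
    ⟨(le_add_of_nonneg_right (expNormRatio_nonneg b (v i) G)).trans (hG i hi),
      (le_add_of_nonneg_left (expNormRatio_nonneg a (v i) G)).trans (hG i hi)⟩⟩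

theorem exists_linearMap_norm_sq_le_and_le (κ : Type*) [Fintype κ] (hv : ∀ i ∈ T, v i ≠ 0)
    (hw : ∑ i ∈ T, Real.exp (-w i) ≤ 1 / 2) :
    ∃ Λ : E →ₗ[ℝ] EuclideanSpace ℝ κ, ∀ i ∈ T,
      ‖Λ (v i)‖ ^ 2 ≤ (2 * Fintype.card κ + 4 * w i) * ‖v i‖ ^ 2 ∧
      (Fintype.card κ / 2 - w i) * ‖v i‖ ^ 2 ≤ ‖Λ (v i)‖ ^ 2 := by
  have hupper : (0 : ℝ) < 1 + 2 * (-1 / 4) := by norm_num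
  have hlower : (0 : ℝ) < 1 + 2 * 1 := by norm_num
  obtain ⟨G, hG⟩ := exists_forall_expNormRatio_le_exp (κ := κ) hv hw hupper hlower
  refine ⟨rowMap G, fun i hi => ?_⟩
  have hz2 : 0 < ‖v i‖ ^ 2 := by
    have := hv i hi
    positivity
  have hn : (0 : ℝ) ≤ Fintype.card κ / 2 := by positivity
  have hlog2 : -1 ≤ Real.log (1 + 2 * (-1 / 4)) := by
    linarith [Real.one_sub_inv_le_log_of_pos hupper]
  have hlog3 : 1 ≤ Real.log (1 + 2 * 1) := by
    rw [Real.le_log_iff_exp_le hlower]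
    linarith [Real.exp_one_lt_d9]
  have h1 := sub_le_of_expNormRatio_le_exp hupper (hG i hi).1
  have h2 := sub_le_of_expNormRatio_le_exp hlower (hG i hi).2
  rw [← div_le_iff₀ hz2, ← le_div_iff₀ hz2]
  constructor
  · linarith [mul_le_mul_of_nonneg_left hlog2 hn]
  · linarith [mul_le_mul_of_nonneg_left hlog3 hn]

end ExistsLinearMap

end Gaussian

section Entropy

variable {ι : Type*}

/-- An integer vector as an element of Euclidean space. -/
noncomputable def intVec (z : ι → ℤ) : EuclideanSpace ℝ ι := WithLp.toLp 2 fun i => (z i : ℝ)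

theorem intVec_ne_zero {z : ι → ℤ} (hz : z ≠ 0) : intVec z ≠ 0 := fun h =>
  hz (funext fun i => by simpa [intVec] using congrArg (fun x : EuclideanSpace ℝ ι => x i) h)

variable [Fintype ι]

/-- The `l_1`-norm of an integer vector. -/
def l1Norm (z : ι → ℤ) : ℕ := ∑ i, (z i).natAbs

theorem natAbs_le_l1Norm (z : ι → ℤ) (i : ι) : (z i).natAbs ≤ l1Norm z :=
  Finset.single_le_sum (f := fun i => (z i).natAbs) (fun _ _ => Nat.zero_le _) (Finset.mem_univ i)

theorem cast_l1Norm (z : ι → ℤ) : (l1Norm z : ℝ) = ∑ i, |(z i : ℝ)| := by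
  simp only [l1Norm, Nat.cast_sum, Nat.cast_natAbs, Int.cast_abs]

theorem l1Norm_eq_zero {z : ι → ℤ} : l1Norm z = 0 ↔ z = 0 := by
  simp [l1Norm, funext_iff]

/-- The integer vectors of `l_1`-norm `k`. -/
noncomputable def latticeSphere (ι : Type*) [Fintype ι] (k : ℕ) : Finset (ι → ℤ) := by
  classical exact {z ∈ Fintype.piFinset fun _ : ι => Finset.Icc (-k : ℤ) k | l1Norm z = k}

theorem mem_latticeSphere {k : ℕ} {z : ι → ℤ} : z ∈ latticeSphere ι k ↔ l1Norm z = k := by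
  classical
  rw [latticeSphere, Finset.mem_filter, and_iff_right_iff_imp]
  rintro rfl
  refine Fintype.mem_piFinset.2 fun i => Finset.mem_Icc.2 ?_
  have := natAbs_le_l1Norm z i
  omega

theorem sum_Icc_pow_natAbs_le (k : ℕ) {t : ℝ} (ht : 0 ≤ t) (ht2 : t ≤ 1 / 2) :
    ∑ j ∈ Finset.Icc (-k : ℤ) k, t ^ j.natAbs ≤ 1 + 4 * t := by
  suffices h : ∑ j ∈ Finset.Icc (-k : ℤ) k, t ^ j.natAbs ≤ 1 + 4 * t - 4 * t ^ (k + 1) by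
    linarith [pow_nonneg ht (k + 1)]
  induction k with
  | zero => simp
  | succ k ih =>
    have hsplit : Finset.Icc (-(k + 1 : ℕ) : ℤ) (k + 1 : ℕ) =
        insert (-(k + 1 : ℕ) : ℤ) (insert ((k + 1 : ℕ) : ℤ) (Finset.Icc (-k : ℤ) k)) := by
      ext j
      simp only [Finset.mem_Icc, Finset.mem_insert]
      omega
    rw [hsplit, Finset.sum_insert (by simp; omega), Finset.sum_insert (by simp), Int.natAbs_neg,
      Int.natAbs_natCast, pow_succ t (k + 1)]
    nlinarith [pow_nonneg ht (k + 1)]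

theorem card_latticeSphere_mul_pow_le (k : ℕ) {t : ℝ} (ht : 0 ≤ t) (ht2 : t ≤ 1 / 2) :
    (latticeSphere ι k).card * t ^ k ≤ Real.exp (4 * t * Fintype.card ι) := by
  classical
  calc (latticeSphere ι k).card * t ^ k
      = ∑ z ∈ latticeSphere ι k, ∏ i, t ^ (z i).natAbs := by
        rw [← nsmul_eq_mul, ← Finset.sum_const]
        refine Finset.sum_congr rfl fun z hz => ?_
        rw [Finset.prod_pow_eq_pow_sum, ← mem_latticeSphere.1 hz, l1Norm]
    _ ≤ ∑ z ∈ Fintype.piFinset fun _ : ι => Finset.Icc (-k : ℤ) k, ∏ i, t ^ (z i).natAbs :=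
        Finset.sum_le_sum_of_subset_of_nonneg (Finset.filter_subset _ _)
          fun _ _ _ => Finset.prod_nonneg fun _ _ => by positivity
    _ = (∑ j ∈ Finset.Icc (-k : ℤ) k, t ^ j.natAbs) ^ Fintype.card ι := by
        rw [← Finset.prod_univ_sum (fun _ : ι => Finset.Icc (-k : ℤ) k) fun _ j => t ^ j.natAbs,
          Finset.prod_const, Finset.card_univ]
    _ ≤ Real.exp (4 * t) ^ Fintype.card ι := by
        gcongr
        linarith [sum_Icc_pow_natAbs_le k ht ht2, Real.add_one_le_exp (4 * t)]
    _ = Real.exp (4 * t * Fintype.card ι) := by rw [← Real.exp_nat_mul, mul_comm]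

/-- The entropy weight `m^{1-θ} N^θ`: up to a constant depending on `θ` it bounds the logarithm of
the number of integer vectors of `l_1`-norm `m` in `ℝ^N`. -/
noncomputable def entropyWeight (θ N m : ℝ) : ℝ := m ^ (1 - θ) * N ^ θ

theorem entropyWeight_nonneg (θ : ℝ) {N m : ℝ} (hN : 0 ≤ N) (hm : 0 ≤ m) :
    0 ≤ entropyWeight θ N m := by
  unfold entropyWeight; positivity

theorem entropyWeight_le_entropyWeight {θ N m m' : ℝ} (hθ : θ ≤ 1) (hN : 0 ≤ N) (hm : 0 ≤ m)
    (h : m ≤ m') : entropyWeight θ N m ≤ entropyWeight θ N m' := by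
  unfold entropyWeight
  gcongr

theorem entropyWeight_eq {θ N m : ℝ} (hN : 0 ≤ N) (hm : 0 < m) :
    entropyWeight θ N m = m * (N / m) ^ θ := by
  rw [entropyWeight, Real.div_rpow hN hm.le, Real.rpow_sub hm, Real.rpow_one]
  ring

theorem le_entropyWeight {θ N m : ℝ} (hθ : 0 ≤ θ) (hm : 0 < m) (h : m ≤ N) :
    m ≤ entropyWeight θ N m := by
  rw [entropyWeight_eq (hm.le.trans h) hm]
  exact le_mul_of_one_le_right hm.le (Real.one_le_rpow ((one_le_div hm).2 h) hθ)

theorem card_latticeSphere_le {θ : ℝ} (hθ : 0 < θ) {k : ℕ} (hk : 0 < k)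
    (hkN : k ≤ Fintype.card ι) :
    ((latticeSphere ι k).card : ℝ) ≤
      Real.exp ((3 + 1 / θ) * entropyWeight θ (Fintype.card ι) k) := by
  set N : ℝ := (Fintype.card ι : ℝ) with hNdef
  have hk0 : (0 : ℝ) < k := by exact_mod_cast hk
  have hkN' : (k : ℝ) ≤ N := Nat.cast_le.2 hkN
  have hN : 0 < N := hk0.trans_le hkN'
  have ht : 0 < k / (2 * N) := by positivity
  have hcard := card_latticeSphere_mul_pow_le (ι := ι) k ht.le
    (by rw [div_le_iff₀ (by positivity)]; linarith)
  rw [← hNdef, ← Real.exp_log (pow_pos ht k), Real.log_pow, ← le_div_iff₀ (Real.exp_pos _),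
    ← Real.exp_sub] at hcard
  refine hcard.trans (Real.exp_le_exp.2 ?_)
  have hu : 1 ≤ N / k := (one_le_div hk0).2 hkN'
  have hlog : Real.log (k / (2 * N)) = -(Real.log 2 + Real.log (N / k)) := by
    rw [← Real.log_mul (by norm_num) (by positivity), ← Real.log_inv]
    congr 1
    field_simp
  have hlog_le := Real.log_le_rpow_div (zero_le_one.trans hu) hθ
  have hone_le := Real.one_le_rpow hu hθ.le
  rw [entropyWeight_eq hN.le hk0, hlog]
  calc 4 * (k / (2 * N)) * N - k * -(Real.log 2 + Real.log (N / k))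
      = k * (2 + Real.log 2 + Real.log (N / k)) := by field_simp; ring
    _ ≤ k * (3 * (N / k) ^ θ + (N / k) ^ θ / θ) := by
        gcongr
        linarith [Real.log_two_lt_d9]
    _ = (3 + 1 / θ) * (k * (N / k) ^ θ) := by ring

theorem sum_card_latticeSphere_mul_exp_neg_le {θ : ℝ} (hθ : 0 < θ) :
    ∑ k ∈ Finset.Icc 1 (Fintype.card ι), (latticeSphere ι k).card *
      Real.exp (-((5 + 1 / θ) * entropyWeight θ (Fintype.card ι) k)) ≤ 1 / 2 := by
  calc _ ≤ ∑ k ∈ Finset.Icc 1 (Fintype.card ι), (1 / 3 : ℝ) ^ k := by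
        refine Finset.sum_le_sum fun k hk => ?_
        obtain ⟨hk1, hkN⟩ := Finset.mem_Icc.1 hk
        have hW : (k : ℝ) ≤ entropyWeight θ (Fintype.card ι) k :=
          le_entropyWeight hθ.le (by exact_mod_cast hk1) (by exact_mod_cast hkN)
        set W := entropyWeight θ (Fintype.card ι) k
        calc (latticeSphere ι k).card * Real.exp (-((5 + 1 / θ) * W))
            ≤ Real.exp ((3 + 1 / θ) * W) * Real.exp (-((5 + 1 / θ) * W)) := by
              gcongr
              exact card_latticeSphere_le hθ hk1 hkN
          _ ≤ Real.exp (k * -2) := by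
              rw [← Real.exp_add]
              exact Real.exp_le_exp.2 (by linarith)
          _ ≤ (1 / 3) ^ k := by
              rw [Real.exp_nat_mul, Real.exp_neg, ← one_div]
              gcongr
              linarith [Real.add_one_le_exp (2 : ℝ)]
    _ ≤ (1 / 3) ^ 1 / (1 - 1 / 3) := geom_sum_Ico_le_of_lt_one (by norm_num) (by norm_num)
    _ = 1 / 2 := by norm_num

theorem norm_intVec_sq (z : ι → ℤ) : ‖intVec z‖ ^ 2 = ∑ i, (z i : ℝ) ^ 2 := by
  simp [intVec, EuclideanSpace.norm_sq_eq]

/-- A linear map `Λ : ℝ^N → ℝ^n` that on integer vectors `z` of small `l_1`-norm behaves like `√n`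
times an isometry, up to an error governed by the entropy of the set of all such `z`. -/
structure IsLatticeEmbedding {κ : Type*} [Fintype κ] (θ A : ℝ)
    (Λ : EuclideanSpace ℝ ι →ₗ[ℝ] EuclideanSpace ℝ κ) : Prop where
  norm_sq_le (z : ι → ℤ) : l1Norm z ≤ Fintype.card ι → ‖Λ (intVec z)‖ ^ 2 ≤
    A * (Fintype.card κ + entropyWeight θ (Fintype.card ι) (l1Norm z)) * ‖intVec z‖ ^ 2
  le_norm_sq (z : ι → ℤ) : l1Norm z ≤ Fintype.card ι →
    A * entropyWeight θ (Fintype.card ι) (l1Norm z) ≤ Fintype.card κ →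
      Fintype.card κ * ‖intVec z‖ ^ 2 ≤ 4 * ‖Λ (intVec z)‖ ^ 2

theorem exists_isLatticeEmbedding (ι κ : Type*) [Fintype ι] [Fintype κ] {θ : ℝ} (hθ : 0 < θ) :
    ∃ Λ : EuclideanSpace ℝ ι →ₗ[ℝ] EuclideanSpace ℝ κ,
      IsLatticeEmbedding θ (4 * (5 + 1 / θ)) Λ := by
  obtain ⟨Λ, hΛ⟩ := exists_linearMap_norm_sq_le_and_le κ
    (T := (Finset.Icc 1 (Fintype.card ι)).sigma (latticeSphere ι)) (v := fun z => intVec z.2)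
    (w := fun z => (5 + 1 / θ) * entropyWeight θ (Fintype.card ι) z.1)
    (fun z hz => by
      rw [Finset.mem_sigma, Finset.mem_Icc, mem_latticeSphere] at hz
      refine intVec_ne_zero fun h0 => ?_
      have := l1Norm_eq_zero.2 h0
      omega)
    (by
      rw [Finset.sum_sigma]
      simpa using sum_card_latticeSphere_mul_exp_neg_le (ι := ι) hθ)
  have hbounds : ∀ z : ι → ℤ, z ≠ 0 → l1Norm z ≤ Fintype.card ι → _ := fun z hz0 hz =>
    hΛ ⟨l1Norm z, z⟩ (Finset.mem_sigma.2 ⟨Finset.mem_Icc.2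
      ⟨Nat.one_le_iff_ne_zero.2 fun h => hz0 (l1Norm_eq_zero.1 h), hz⟩, mem_latticeSphere.2 rfl⟩)
  have h0 : intVec (0 : ι → ℤ) = 0 := by ext; simp [intVec]
  have hA : 2 ≤ 4 * (5 + 1 / θ) := by linarith [one_div_pos.2 hθ]
  refine ⟨Λ, fun z hz => ?_, fun z hz hzn => ?_⟩ <;> rcases eq_or_ne z 0 with rfl | hz0
  · simp [h0]
  · linarith [(hbounds z hz0 hz).1, mul_le_mul_of_nonneg_right
      (mul_le_mul_of_nonneg_right hA (Nat.cast_nonneg (Fintype.card κ))) (sq_nonneg ‖intVec z‖)]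
  · simp [h0]
  · have hlower := (hbounds z hz0 hz).2
    have hquarter : (Fintype.card κ : ℝ) / 4 ≤
        Fintype.card κ / 2 - (5 + 1 / θ) * entropyWeight θ (Fintype.card ι) (l1Norm z) := by
      linarith
    linarith [mul_le_mul_of_nonneg_right hquarter (sq_nonneg ‖intVec z‖)]

end Entropy

section Rounding

theorem abs_round_le_two_mul_abs (u : ℝ) : |(round u : ℝ)| ≤ 2 * |u| := by
  have h := round_le u 0
  rw [Int.cast_zero, sub_zero] at h
  linarith [abs_sub_abs_le_abs_sub (round u : ℝ) u, abs_sub_comm u (round u)]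

theorem abs_round_two_mul_sub_le (u : ℝ) :
    |(round (2 * u) : ℝ) - 2 * round u| ≤ 4 * |u| := by
  have h := round_le u 0
  have h2 := round_le (2 * u) 0
  rw [Int.cast_zero, sub_zero] at h h2
  rw [abs_mul, abs_two] at h2
  rw [abs_le] at *
  constructor <;> linarith

theorem abs_round_two_mul_sub_le_one (u : ℝ) : |round (2 * u) - 2 * round u| ≤ 1 := by
  rw [← Int.lt_add_one_iff, ← Int.cast_lt (R := ℝ)]
  push_cast
  have h := abs_sub_round u
  have h2 := abs_sub_round (2 * u)
  rw [abs_le] at h h2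
  rw [abs_lt]
  constructor <;> linarith

theorem abs_intCast_le_rpow_of_le {k : ℤ} {t p : ℝ} (hp : 1 ≤ p) (h : |(k : ℝ)| ≤ t) :
    |(k : ℝ)| ≤ t ^ p := by
  have ht : 0 ≤ t := (abs_nonneg _).trans h
  rcases eq_or_ne k 0 with rfl | hk
  · simpa using Real.rpow_nonneg ht p
  · have h1 : (1 : ℝ) ≤ |(k : ℝ)| := by exact_mod_cast Int.one_le_abs hk
    exact h.trans (Real.self_le_rpow_of_one_le (h1.trans h) hp)

variable {ι : Type*}

/-- Coordinatewise rounding to the nearest point of the grid `b ℤ`. -/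
noncomputable def gridRound (b : ℝ) (x : EuclideanSpace ℝ ι) : EuclideanSpace ℝ ι :=
  b • intVec fun i => round (x i / b)

/-- The integer digits, in `{-1, 0, 1}`, that refine the rounding at mesh `2 b` to mesh `b`. -/
noncomputable def gridDigit (b : ℝ) (x : EuclideanSpace ℝ ι) (i : ι) : ℤ :=
  round (x i / b) - 2 * round (x i / (2 * b))

theorem gridRound_sub_gridRound_two_mul (b : ℝ) (x : EuclideanSpace ℝ ι) :
    gridRound b x - gridRound (2 * b) x = b • intVec (gridDigit b x) := by
  ext i
  simp only [gridRound, gridDigit, intVec, PiLp.sub_apply, PiLp.smul_apply, smul_eq_mul]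
  push_cast
  ring

theorem abs_gridDigit_le_one (b : ℝ) (x : EuclideanSpace ℝ ι) (i : ι) : |gridDigit b x i| ≤ 1 := by
  have h := abs_round_two_mul_sub_le_one (x i / (2 * b))
  rwa [← mul_div_assoc, mul_div_mul_left _ _ two_ne_zero] at h

theorem abs_gridDigit_le {b : ℝ} (hb : 0 < b) (x : EuclideanSpace ℝ ι) (i : ι) :
    |(gridDigit b x i : ℝ)| ≤ 2 * |x i| / b := by
  have h := abs_round_two_mul_sub_le (x i / (2 * b))
  rw [← mul_div_assoc, mul_div_mul_left _ _ two_ne_zero, abs_div,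
    abs_of_pos (by positivity : 0 < 2 * b)] at h
  calc |(gridDigit b x i : ℝ)| = |(round (x i / b) : ℝ) - 2 * round (x i / (2 * b))| := by
        rw [gridDigit]; push_cast; rfl
    _ ≤ 4 * (|x i| / (2 * b)) := h
    _ = 2 * |x i| / b := by field_simp; ring

theorem abs_round_div_le {b : ℝ} (hb : 0 < b) (u : ℝ) : |(round (u / b) : ℝ)| ≤ 2 * |u| / b := by
  simpa [abs_div, abs_of_pos hb, mul_div_assoc] using abs_round_le_two_mul_abs (u / b)

variable [Fintype ι] {p : ℝ} {x : EuclideanSpace ℝ ι}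

theorem l1Norm_le_rpow_neg (hp : 1 ≤ p) (hx : ∑ i, (2 * |x i|) ^ p ≤ 1) {b : ℝ} (hb : 0 < b)
    {z : ι → ℤ} (hz : ∀ i, |(z i : ℝ)| ≤ 2 * |x i| / b) : (l1Norm z : ℝ) ≤ b ^ (-p) := by
  calc (l1Norm z : ℝ) ≤ ∑ i, (2 * |x i| / b) ^ p := by
        rw [cast_l1Norm]
        exact Finset.sum_le_sum fun i _ => abs_intCast_le_rpow_of_le hp (hz i)
    _ = (∑ i, (2 * |x i|) ^ p) * b ^ (-p) := by
        rw [Finset.sum_mul]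
        refine Finset.sum_congr rfl fun i _ => ?_
        rw [Real.div_rpow (by positivity) hb.le, Real.rpow_neg hb.le, div_eq_mul_inv]
    _ ≤ b ^ (-p) := mul_le_of_le_one_left (by positivity) hx

theorem norm_intVec_sq_eq_l1Norm {z : ι → ℤ} (hz : ∀ i, |z i| ≤ 1) :
    ‖intVec z‖ ^ 2 = l1Norm z := by
  rw [norm_intVec_sq, cast_l1Norm]
  refine Finset.sum_congr rfl fun i _ => ?_
  obtain ⟨h1, h2⟩ := abs_le.1 (hz i)
  interval_cases z i <;> simp

theorem l1Norm_le_card {z : ι → ℤ} (hz : ∀ i, |z i| ≤ 1) : l1Norm z ≤ Fintype.card ι := by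
  calc l1Norm z ≤ ∑ _ : ι, 1 := Finset.sum_le_sum fun i _ => by
        have := hz i
        rw [Int.abs_eq_natAbs] at this
        omega
    _ = Fintype.card ι := by simp

theorem norm_sub_gridRound_le (hp : 0 ≤ p) (hp2 : p ≤ 2) (hx : ∑ i, (2 * |x i|) ^ p ≤ 1) {b : ℝ}
    (hb : 0 < b) : ‖x - gridRound b x‖ ≤ b ^ (1 - p / 2) := by
  have hcoord : ∀ i, (x i - gridRound b x i) ^ 2 ≤ b ^ (2 - p) * (2 * |x i|) ^ p := by
    intro i
    have habs : |x i - gridRound b x i| = b * |x i / b - round (x i / b)| := by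
      rw [← abs_of_pos hb, ← abs_mul, abs_of_pos hb, mul_sub, mul_div_cancel₀ _ hb.ne']
      rfl
    have hmesh : |x i - gridRound b x i| ≤ b := by
      rw [habs]
      exact mul_le_of_le_one_right hb.le ((abs_sub_round _).trans (by norm_num))
    have hsize : |x i - gridRound b x i| ≤ 2 * |x i| := by
      have h := round_le (x i / b) 0
      rw [Int.cast_zero, sub_zero, abs_div, abs_of_pos hb, le_div_iff₀' hb, ← habs] at h
      linarith [abs_nonneg (x i)]
    rw [← sq_abs, ← Real.rpow_two, ← sub_add_cancel 2 p,
      Real.rpow_add_of_nonneg (abs_nonneg _) (by linarith) hp, sub_add_cancel]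
    gcongr
  refine (abs_le_of_sq_le_sq' ?_ (by positivity)).2
  rw [EuclideanSpace.norm_sq_eq, ← Real.rpow_natCast (b ^ _), ← Real.rpow_mul hb.le]
  calc ∑ i, ‖(x - gridRound b x) i‖ ^ 2 ≤ ∑ i, b ^ (2 - p) * (2 * |x i|) ^ p :=
        Finset.sum_le_sum fun i _ => by simpa using hcoord i
    _ = b ^ (2 - p) * ∑ i, (2 * |x i|) ^ p := by rw [Finset.mul_sum]
    _ ≤ b ^ (2 - p) := mul_le_of_le_one_right (by positivity) hx
    _ = b ^ ((1 - p / 2) * (2 : ℕ)) := by congr 1; push_cast; ring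

end Rounding

section Chaining

theorem min_inv_le_mul_sub {v r : ℝ} (hv : 0 < v) (hr : 0 < r) (hr1 : r < 1) :
    min v v⁻¹ ≤ 4 / (1 - r) * (v / (1 + v) - v * r / (1 + v * r)) := by
  have hr1' : 0 < 1 - r := by linarith
  have hdiff : 4 / (1 - r) * (v / (1 + v) - v * r / (1 + v * r)) =
      4 * v / ((1 + v) * (1 + v * r)) := by
    field_simp
    ring
  have hvr : v * r ≤ v := mul_le_of_le_one_right hv.le hr1.le
  calc min v v⁻¹ ≤ 4 * v / ((1 + v) * (1 + v)) := by
        rw [le_div_iff₀ (by positivity)]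
        rcases le_total v 1 with h | h
        · calc min v v⁻¹ * ((1 + v) * (1 + v)) ≤ v * 4 := by
                gcongr
                · exact min_le_left _ _
                · nlinarith
            _ = 4 * v := mul_comm _ _
        · have hmin : min v v⁻¹ * (v * v) ≤ v := by
            calc min v v⁻¹ * (v * v) ≤ v⁻¹ * (v * v) := by gcongr; exact min_le_right _ _
              _ = v := by field_simp
          have hsq : (1 + v) * (1 + v) ≤ 4 * (v * v) := by nlinarith
          linarith [mul_le_mul_of_nonneg_left hsq (by positivity : 0 ≤ min v v⁻¹)]
    _ ≤ 4 * v / ((1 + v) * (1 + v * r)) := by gcongr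
    _ = _ := hdiff.symm

theorem sum_min_geometric_inv_le {v r : ℝ} (hv : 0 < v) (hr : 0 < r) (hr1 : r < 1) (J : ℕ) :
    ∑ j ∈ Finset.range J, min (v * r ^ j) (v * r ^ j)⁻¹ ≤ 4 / (1 - r) := by
  have hr1' : 0 < 1 - r := by linarith
  have hfrac : ∀ j : ℕ, 0 ≤ v * r ^ j / (1 + v * r ^ j) := fun j => by positivity
  have hfrac1 : ∀ j : ℕ, v * r ^ j / (1 + v * r ^ j) ≤ 1 := fun j =>
    div_le_one_of_le₀ (by linarith) (by positivity)
  calc ∑ j ∈ Finset.range J, min (v * r ^ j) (v * r ^ j)⁻¹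
      ≤ ∑ j ∈ Finset.range J, 4 / (1 - r) * (v * r ^ j / (1 + v * r ^ j) -
          v * r ^ (j + 1) / (1 + v * r ^ (j + 1))) :=
        Finset.sum_le_sum fun j _ => by
          rw [pow_succ, ← mul_assoc]
          exact min_inv_le_mul_sub (by positivity) hr hr1
    _ = 4 / (1 - r) * (v * r ^ 0 / (1 + v * r ^ 0) - v * r ^ J / (1 + v * r ^ J)) := by
        rw [← Finset.mul_sum, Finset.sum_range_sub']
    _ ≤ 4 / (1 - r) :=
        mul_le_of_le_one_right (by positivity) (by linarith [hfrac J, hfrac1 0])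

theorem norm_le_of_tendsto_zero_of_sum_norm_sub_le {F : Type*} [SeminormedAddCommGroup F]
    {u : ℕ → F} (hu : Filter.Tendsto u Filter.atTop (nhds 0)) {d : ℕ → ℝ} {B : ℝ}
    (hd : ∀ j, ‖u (j + 1) - u j‖ ≤ d j) (hB : ∀ J, ∑ j ∈ Finset.range J, d j ≤ B) :
    ‖u 0‖ ≤ B := by
  have hdist : ∀ J, dist (u 0) (u J) ≤ B := fun J =>
    (dist_le_range_sum_of_dist_le J fun {j} _ => by
      rw [dist_comm, dist_eq_norm]
      exact hd j).trans (hB J)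
  simpa using le_of_tendsto' (tendsto_const_nhds.dist hu) hdist

theorem entropyWeight_rpow_neg {p : ℝ} (hp : p ≠ 0) (N : ℝ) {b : ℝ} (hb : 0 < b) :
    entropyWeight (1 - 1 / p) N (b ^ (-p)) = b⁻¹ * N ^ (1 - 1 / p) := by
  rw [entropyWeight, ← Real.rpow_mul hb.le, ← Real.rpow_neg_one]
  congr 2
  field_simp
  ring

theorem entropyWeight_self (θ : ℝ) {N : ℝ} (hN : 0 < N) : entropyWeight θ N N = N := by
  rw [entropyWeight, ← Real.rpow_add hN, sub_add_cancel, Real.rpow_one]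

theorem mul_entropyWeight_le_mul_entropyWeight {θ N m m' : ℝ} (hθ : θ ≤ 1) (hN : 0 ≤ N)
    (hm : 0 ≤ m) (h : m ≤ m') : m * entropyWeight θ N m ≤ m' * entropyWeight θ N m' :=
  mul_le_mul h (entropyWeight_le_entropyWeight hθ hN hm h) (entropyWeight_nonneg _ hN hm)
    (hm.trans h)

theorem sq_mul_mul_entropyWeight_le {p N b m : ℝ} (hp : 1 < p) (hp3 : p ≤ 3) (hN : 0 < N)
    (hb : 0 < b) (hm : 0 ≤ m) (hmb : m ≤ b ^ (-p)) (hmN : m ≤ N) :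
    b ^ 2 * (m * entropyWeight (1 - 1 / p) N m) ≤
      (N ^ (1 - 1 / p) * min ((b * N ^ (1 / p)) ^ ((p - 1) / 2))
        ((b * N ^ (1 / p)) ^ ((p - 1) / 2))⁻¹) ^ 2 := by
  have hp0 : 0 < p := by linarith
  have hθ1 : 1 - 1 / p ≤ 1 := by linarith [one_div_pos.2 hp0]
  have hmul : ∀ m', m ≤ m' → m * entropyWeight (1 - 1 / p) N m ≤
      m' * entropyWeight (1 - 1 / p) N m' := fun m' =>
    mul_entropyWeight_le_mul_entropyWeight hθ1 hN.le hm
  have hNP : N ^ (1 - 1 / p) * N ^ (1 / p) = N := by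
    rw [← Real.rpow_add hN, sub_add_cancel, Real.rpow_one]
  set s := b * N ^ (1 / p) with hs
  have hs0 : 0 < s := by positivity
  rcases le_total s 1 with h1 | h1
  · have hle : s ^ ((p - 1) / 2) ≤ 1 := Real.rpow_le_one hs0.le h1 (by linarith)
    rw [min_eq_left (hle.trans (one_le_inv_iff₀.2 ⟨by positivity, hle⟩))]
    calc b ^ 2 * (m * entropyWeight (1 - 1 / p) N m) ≤ b ^ 2 * (N * N) := by
          refine mul_le_mul_of_nonneg_left ((hmul N hmN).trans_eq ?_) (sq_nonneg b)
          rw [entropyWeight_self _ hN]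
      _ = (N ^ (1 - 1 / p) * s) ^ 2 := by
          have hbN : N ^ (1 - 1 / p) * s = b * N := by rw [hs, mul_left_comm, hNP]
          rw [hbN]
          ring
      _ ≤ (N ^ (1 - 1 / p) * s ^ ((p - 1) / 2)) ^ 2 := by
          gcongr
          simpa using Real.rpow_le_rpow_of_exponent_ge hs0 h1 (show (p - 1) / 2 ≤ 1 by linarith)
  · have hle : 1 ≤ s ^ ((p - 1) / 2) := Real.one_le_rpow h1 (by linarith)
    rw [min_eq_right ((inv_le_one_of_one_le₀ hle).trans hle)]
    have hsq : (s ^ ((p - 1) / 2)) ^ 2 = b ^ p * b⁻¹ * N ^ (1 - 1 / p) := by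
      rw [← Real.rpow_natCast, ← Real.rpow_mul hs0.le, hs, Real.mul_rpow hb.le (by positivity),
        ← Real.rpow_mul hN.le, ← Real.rpow_neg_one, ← Real.rpow_add hb]
      congr 2 <;> push_cast <;> field_simp
      ring
    calc b ^ 2 * (m * entropyWeight (1 - 1 / p) N m)
        ≤ b ^ 2 * (b ^ (-p) * (b⁻¹ * N ^ (1 - 1 / p))) := by
          refine mul_le_mul_of_nonneg_left ((hmul _ hmb).trans_eq ?_) (sq_nonneg b)
          rw [entropyWeight_rpow_neg hp0.ne' N hb]
      _ = (N ^ (1 - 1 / p) * (s ^ ((p - 1) / 2))⁻¹) ^ 2 := by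
          rw [mul_pow, inv_pow, hsq, Real.rpow_neg hb.le]
          field_simp

/-- Bound for one dyadic layer of the rounding, of mesh `b`, under a lattice embedding of an
`N`-dimensional space into a `t ^ 2`-dimensional one. The first summand is the dimensional term, the
second one the entropy term, which decays geometrically away from the mesh `N ^ (-(1 / p))`. -/
noncomputable def layerBound (p N t b : ℝ) : ℝ :=
  t * b ^ (1 - p / 2) + N ^ (1 - 1 / p) *
    min ((b * N ^ (1 / p)) ^ ((p - 1) / 2)) ((b * N ^ (1 / p)) ^ ((p - 1) / 2))⁻¹

variable {ι κ : Type*} [Fintype ι] [Fintype κ] {p A : ℝ}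
  {Λ : EuclideanSpace ℝ ι →ₗ[ℝ] EuclideanSpace ℝ κ} {x : EuclideanSpace ℝ ι}

theorem IsLatticeEmbedding.norm_map_gridRound_sub_le (hΛ : IsLatticeEmbedding (1 - 1 / p) A Λ)
    (hA : 0 ≤ A) (hp : 1 < p) (hp3 : p ≤ 3) (hι : 0 < Fintype.card ι)
    (hx : ∑ i, (2 * |x i|) ^ p ≤ 1) {b : ℝ} (hb : 0 < b) :
    ‖Λ (gridRound b x) - Λ (gridRound (2 * b) x)‖ ≤
      √A * layerBound p (Fintype.card ι) √(Fintype.card κ) b := by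
  have hz1 := abs_gridDigit_le_one b x
  have hm := l1Norm_le_rpow_neg hp.le hx hb (abs_gridDigit_le hb x)
  have hmN : (l1Norm (gridDigit b x) : ℝ) ≤ Fintype.card ι := Nat.cast_le.2 (l1Norm_le_card hz1)
  have hΛz := hΛ.norm_sq_le (gridDigit b x) (l1Norm_le_card hz1)
  rw [norm_intVec_sq_eq_l1Norm hz1] at hΛz
  have hentropy := sq_mul_mul_entropyWeight_le hp hp3 (Nat.cast_pos.2 hι) hb
    (Nat.cast_nonneg _) hm hmN
  rw [layerBound]
  set m : ℝ := (l1Norm (gridDigit b x) : ℝ)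
  set S := (Fintype.card ι : ℝ) ^ (1 - 1 / p) *
    min ((b * (Fintype.card ι : ℝ) ^ (1 / p)) ^ ((p - 1) / 2))
      ((b * (Fintype.card ι : ℝ) ^ (1 / p)) ^ ((p - 1) / 2))⁻¹
  have hS : 0 ≤ S := by positivity
  clear_value S
  have hrpow : b ^ 2 * b ^ (-p) = (b ^ (1 - p / 2)) ^ 2 := by
    rw [← Real.rpow_natCast, ← Real.rpow_natCast, ← Real.rpow_mul hb.le, ← Real.rpow_add hb]
    congr 1
    push_cast
    ring
  rw [← map_sub, gridRound_sub_gridRound_two_mul, map_smul, norm_smul, Real.norm_of_nonneg hb.le]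
  refine (abs_le_of_sq_le_sq' ?_ (by positivity)).2
  calc (b * ‖Λ (intVec (gridDigit b x))‖) ^ 2
      ≤ b ^ 2 * (A * (Fintype.card κ + entropyWeight (1 - 1 / p) (Fintype.card ι) m) * m) := by
        rw [mul_pow]
        gcongr
    _ = A * (Fintype.card κ * (b ^ 2 * m) +
          b ^ 2 * (m * entropyWeight (1 - 1 / p) (Fintype.card ι) m)) := by ring
    _ ≤ A * (Fintype.card κ * (b ^ 2 * b ^ (-p)) + S ^ 2) := by gcongr
    _ = √A ^ 2 * ((√(Fintype.card κ) * b ^ (1 - p / 2)) ^ 2 + S ^ 2) := by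
        rw [hrpow, mul_pow √(Fintype.card κ : ℝ), Real.sq_sqrt hA,
          Real.sq_sqrt (Nat.cast_nonneg _)]
    _ ≤ (√A * (√(Fintype.card κ) * b ^ (1 - p / 2) + S)) ^ 2 := by
        rw [mul_pow √A]
        refine mul_le_mul_of_nonneg_left ?_ (sq_nonneg _)
        nlinarith [mul_nonneg (by positivity : 0 ≤ √(Fintype.card κ) * b ^ (1 - p / 2)) hS]

theorem tendsto_gridRound (hp : 0 ≤ p) (hp2 : p < 2) (hx : ∑ i, (2 * |x i|) ^ p ≤ 1) {a : ℝ}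
    (ha : 0 < a) :
    Filter.Tendsto (fun j : ℕ => gridRound (a * (1 / 2) ^ j) x) Filter.atTop (nhds x) := by
  rw [tendsto_iff_norm_sub_tendsto_zero]
  have hmesh : Filter.Tendsto (fun j : ℕ => a * (1 / 2 : ℝ) ^ j) Filter.atTop (nhds 0) := by
    simpa using (tendsto_pow_atTop_nhds_zero_of_lt_one (by norm_num : (0 : ℝ) ≤ 1 / 2)
      (by norm_num)).const_mul a
  have hexp : 0 < 1 - p / 2 := by linarith
  have hbound := hmesh.rpow_const (p := 1 - p / 2) (Or.inr hexp.le)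
  rw [Real.zero_rpow hexp.ne'] at hbound
  refine squeeze_zero (fun j => norm_nonneg _) (fun j => ?_) hbound
  rw [norm_sub_rev]
  exact norm_sub_gridRound_le hp hp2.le hx (by positivity)

/-- The constant that dyadic chaining over the meshes `a / 2 ^ j` produces: bounds for the
geometric series of ratios `2 ^ (-(1 - p / 2))` and `2 ^ (-((p - 1) / 2))`. -/
noncomputable def chainConst (p : ℝ) : ℝ :=
  1 / (1 - (1 / 2) ^ (1 - p / 2)) + 4 / (1 - (1 / 2) ^ ((p - 1) / 2))

theorem half_rpow_lt_one {t : ℝ} (ht : 0 < t) : (1 / 2 : ℝ) ^ t < 1 :=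
  Real.rpow_lt_one (by norm_num) (by norm_num) ht

theorem chainConst_nonneg (hp : 1 < p) (hp2 : p < 2) : 0 ≤ chainConst p := by
  have h1 : (1 / 2 : ℝ) ^ (1 - p / 2) < 1 := half_rpow_lt_one (by linarith)
  have h2 : (1 / 2 : ℝ) ^ ((p - 1) / 2) < 1 := half_rpow_lt_one (by linarith)
  exact add_nonneg (div_nonneg zero_le_one (by linarith)) (div_nonneg zero_le_four (by linarith))

theorem sum_layerBound_le (hp : 1 < p) (hp2 : p < 2) {N t a B : ℝ} (hN : 0 < N) (ht : 0 ≤ t)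
    (ha : 0 < a) (htB : t * a ^ (1 - p / 2) ≤ B) (hNB : N ^ (1 - 1 / p) ≤ B) (J : ℕ) :
    ∑ j ∈ Finset.range J, layerBound p N t (a / 2 * (1 / 2) ^ j) ≤ chainConst p * B := by
  set s : ℝ := (1 / 2) ^ (1 - p / 2)
  set r : ℝ := (1 / 2) ^ ((p - 1) / 2)
  have hs1 : s < 1 := half_rpow_lt_one (by linarith)
  have hr1 : r < 1 := half_rpow_lt_one (by linarith)
  have hs0 : 0 < s := by positivity
  have hr0 : 0 < r := by positivity
  have hpow : ∀ (j : ℕ) (e : ℝ), ((1 / 2 : ℝ) ^ j) ^ e = ((1 / 2) ^ e) ^ j := fun j e => by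
    rw [← Real.rpow_natCast, ← Real.rpow_mul (by norm_num), mul_comm, Real.rpow_mul (by norm_num),
      Real.rpow_natCast]
  have hlayer1 : ∀ j : ℕ, t * (a / 2 * (1 / 2) ^ j) ^ (1 - p / 2) ≤ B * s ^ j := fun j => by
    rw [Real.mul_rpow (by positivity) (by positivity), hpow, ← mul_assoc]
    refine mul_le_mul_of_nonneg_right (le_trans ?_ htB) (by positivity)
    gcongr <;> linarith
  have hlayer2 : ∀ j : ℕ, (a / 2 * (1 / 2) ^ j * N ^ (1 / p)) ^ ((p - 1) / 2) =
      (a / 2 * N ^ (1 / p)) ^ ((p - 1) / 2) * r ^ j := fun j => by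
    rw [mul_right_comm, Real.mul_rpow (by positivity) (by positivity), hpow]
  have hB : 0 ≤ B := le_trans (by positivity) hNB
  have hgeom : ∑ j ∈ Finset.range J, s ^ j ≤ 1 / (1 - s) := by
    rw [Finset.range_eq_Ico]
    simpa using geom_sum_Ico_le_of_lt_one (m := 0) (n := J) hs0.le hs1
  simp only [layerBound, hlayer2]
  rw [Finset.sum_add_distrib, chainConst, add_mul]
  refine add_le_add ?_ ?_
  · calc _ ≤ ∑ j ∈ Finset.range J, B * s ^ j := Finset.sum_le_sum fun j _ => hlayer1 j
      _ ≤ 1 / (1 - s) * B := by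
        rw [← Finset.mul_sum, mul_comm]
        gcongr
  · rw [← Finset.mul_sum, mul_comm]
    exact mul_le_mul (sum_min_geometric_inv_le (by positivity) hr0 hr1 J) hNB (by positivity)
      (div_nonneg zero_le_four (by linarith))

theorem IsLatticeEmbedding.norm_map_gridRound_le_of_map_eq_zero
    (hΛ : IsLatticeEmbedding (1 - 1 / p) A Λ) (hA : 0 ≤ A) (hp : 1 < p) (hp2 : p < 2)
    (hι : 0 < Fintype.card ι) (hx : ∑ i, (2 * |x i|) ^ p ≤ 1) (hΛx : Λ x = 0) {a B : ℝ} (ha : 0 < a)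
    (haB : √(Fintype.card κ) * a ^ (1 - p / 2) ≤ B)
    (hB : (Fintype.card ι : ℝ) ^ (1 - 1 / p) ≤ B) :
    ‖Λ (gridRound a x)‖ ≤ √A * (chainConst p * B) := by
  have hlim : Filter.Tendsto (fun j : ℕ => Λ (gridRound (a * (1 / 2) ^ j) x)) Filter.atTop
      (nhds 0) := by
    rw [← hΛx]
    exact (Λ.continuous_of_finiteDimensional.tendsto x).comp
      (tendsto_gridRound (by linarith) hp2 hx ha)
  rw [← mul_one a, ← pow_zero (1 / 2 : ℝ)]
  refine norm_le_of_tendsto_zero_of_sum_norm_sub_le hlim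
    (d := fun j => √A * layerBound p (Fintype.card ι) √(Fintype.card κ) (a / 2 * (1 / 2) ^ j))
    (fun j => ?_) fun J => ?_
  · have hfine : a * (1 / 2) ^ (j + 1) = a / 2 * (1 / 2) ^ j := by ring
    have hcoarse : a * (1 / 2) ^ j = 2 * (a / 2 * (1 / 2) ^ j) := by ring
    rw [hfine, hcoarse]
    exact hΛ.norm_map_gridRound_sub_le hA hp (by linarith) hι hx (by positivity)
  · rw [← Finset.mul_sum]
    gcongr
    exact sum_layerBound_le hp hp2 (Nat.cast_pos.2 hι) (Real.sqrt_nonneg _) ha haB hB J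

theorem coarseMesh_rpow_neg_le {A N n : ℝ} (hA : 1 ≤ A) (hp : 0 < p) (hn : 0 < n) (hnN : n ≤ N) :
    (A * N ^ (1 - 1 / p) / n) ^ (-p) ≤ N := by
  have hN : 0 < N := hn.trans_le hnN
  have hmesh : N ^ (-(1 / p)) ≤ A * N ^ (1 - 1 / p) / n := by
    have hsplit : N ^ (1 - 1 / p) = N * N ^ (-(1 / p)) := by
      rw [sub_eq_add_neg, Real.rpow_add hN, Real.rpow_one]
    rw [le_div_iff₀ hn, hsplit, mul_comm]
    exact (mul_le_mul_of_nonneg_right hnN (by positivity)).trans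
      (le_mul_of_one_le_left (by positivity) hA)
  calc (A * N ^ (1 - 1 / p) / n) ^ (-p) ≤ (N ^ (-(1 / p))) ^ (-p) :=
        Real.rpow_le_rpow_of_nonpos (by positivity) hmesh (by linarith)
    _ = N := by
        rw [← Real.rpow_mul hN.le, neg_mul_neg, one_div_mul_cancel hp.ne', Real.rpow_one]

theorem sqrt_mul_coarseMesh_rpow_le {A N n : ℝ} (hA : 1 ≤ A) (hp : 1 ≤ p)
    (hn : 0 < n) (hnN : n ≤ N) :
    √n * (A * N ^ (1 - 1 / p) / n) ^ (1 - p / 2) ≤ A * N ^ (1 - 1 / p) := by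
  have hN : 0 < N := hn.trans_le hnN
  have hp0 : 0 < p := by linarith
  have hdim : √n * n ^ (-(1 - p / 2)) = n ^ ((p - 1) / 2) := by
    rw [Real.sqrt_eq_rpow, ← Real.rpow_add hn]
    congr 1
    ring
  have hexp : N ^ ((p - 1) / 2) * (N ^ (1 - 1 / p)) ^ (1 - p / 2) = N ^ (1 - 1 / p) := by
    rw [← Real.rpow_mul hN.le, ← Real.rpow_add hN]
    congr 1
    field_simp
    ring
  calc √n * (A * N ^ (1 - 1 / p) / n) ^ (1 - p / 2)
      = A ^ (1 - p / 2) * (n ^ ((p - 1) / 2) * (N ^ (1 - 1 / p)) ^ (1 - p / 2)) := by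
        rw [Real.div_rpow (by positivity) hn.le, Real.mul_rpow (by positivity) (by positivity),
          ← hdim, Real.rpow_neg hn.le]
        ring
    _ ≤ A ^ (1 : ℝ) * (N ^ ((p - 1) / 2) * (N ^ (1 - 1 / p)) ^ (1 - p / 2)) := by
        gcongr
        linarith
    _ = A * N ^ (1 - 1 / p) := by rw [Real.rpow_one, hexp]

theorem IsLatticeEmbedding.sqrt_card_mul_norm_gridRound_le
    (hΛ : IsLatticeEmbedding (1 - 1 / p) A Λ) (hA : 1 ≤ A) (hp : 1 ≤ p)
    (hκ : 0 < Fintype.card κ) (hκι : Fintype.card κ ≤ Fintype.card ι)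
    (hx : ∑ i, (2 * |x i|) ^ p ≤ 1) {a : ℝ}
    (ha : a = A * (Fintype.card ι : ℝ) ^ (1 - 1 / p) / Fintype.card κ) :
    √(Fintype.card κ) * ‖gridRound a x‖ ≤ 2 * ‖Λ (gridRound a x)‖ := by
  have hn : (0 : ℝ) < Fintype.card κ := Nat.cast_pos.2 hκ
  have hnN : (Fintype.card κ : ℝ) ≤ Fintype.card ι := Nat.cast_le.2 hκι
  have hN : (0 : ℝ) < Fintype.card ι := hn.trans_le hnN
  have hp0 : 0 < p := by linarith
  have ha0 : 0 < a := ha ▸ by positivity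
  set z : ι → ℤ := fun i => round (x i / a)
  have hm : (l1Norm z : ℝ) ≤ a ^ (-p) :=
    l1Norm_le_rpow_neg hp hx ha0 fun i => abs_round_div_le ha0 (x i)
  have hcard : l1Norm z ≤ Fintype.card ι := by
    exact_mod_cast hm.trans (ha ▸ coarseMesh_rpow_neg_le hA hp0 hn hnN)
  have hentropy : A * entropyWeight (1 - 1 / p) (Fintype.card ι) (l1Norm z) ≤ Fintype.card κ := by
    calc _ ≤ A * entropyWeight (1 - 1 / p) (Fintype.card ι) (a ^ (-p)) := by
          gcongr
          exact entropyWeight_le_entropyWeight (by linarith [one_div_pos.2 hp0]) hN.le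
            (Nat.cast_nonneg _) hm
      _ = Fintype.card κ := by
          rw [entropyWeight_rpow_neg hp0.ne' _ ha0, ha]
          field_simp
  have hlower := hΛ.le_norm_sq z hcard hentropy
  have hlattice : √(Fintype.card κ) * ‖intVec z‖ ≤ 2 * ‖Λ (intVec z)‖ := by
    refine (abs_le_of_sq_le_sq' ?_ (by positivity)).2
    rw [mul_pow, mul_pow, Real.sq_sqrt hn.le]
    linarith
  have hround : gridRound a x = a • intVec z := rfl
  rw [hround, map_smul, norm_smul, norm_smul, Real.norm_of_nonneg ha0.le]
  linarith [mul_le_mul_of_nonneg_left hlattice ha0.le]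

theorem IsLatticeEmbedding.sqrt_card_mul_norm_le_of_map_eq_zero
    (hΛ : IsLatticeEmbedding (1 - 1 / p) A Λ) (hA : 1 ≤ A) (hp : 1 < p) (hp2 : p < 2)
    (hκ : 0 < Fintype.card κ) (hκι : Fintype.card κ ≤ Fintype.card ι)
    (hx : ∑ i, (2 * |x i|) ^ p ≤ 1) (hΛx : Λ x = 0) :
    √(Fintype.card κ) * ‖x‖ ≤
      (2 * √A * chainConst p + 1) * (A * (Fintype.card ι : ℝ) ^ (1 - 1 / p)) := by
  have hn : (0 : ℝ) < Fintype.card κ := Nat.cast_pos.2 hκ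
  have hnN : (Fintype.card κ : ℝ) ≤ Fintype.card ι := Nat.cast_le.2 hκι
  have hN : (0 : ℝ) < Fintype.card ι := hn.trans_le hnN
  set P := (Fintype.card ι : ℝ) ^ (1 - 1 / p)
  obtain ⟨a, ha⟩ : ∃ a, a = A * P / Fintype.card κ := ⟨_, rfl⟩
  have ha0 : 0 < a := ha ▸ by positivity
  have hmesh : √(Fintype.card κ) * a ^ (1 - p / 2) ≤ A * P :=
    ha ▸ sqrt_mul_coarseMesh_rpow_le hA hp.le hn hnN
  have hcoarse := hΛ.sqrt_card_mul_norm_gridRound_le hA hp.le hκ hκι hx ha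
  have hchain := hΛ.norm_map_gridRound_le_of_map_eq_zero (zero_le_one.trans hA) hp hp2
    (hκ.trans_le hκι) hx hΛx ha0 hmesh (le_mul_of_one_le_left (by positivity) hA)
  calc √(Fintype.card κ) * ‖x‖
      ≤ √(Fintype.card κ) * (‖gridRound a x‖ + ‖x - gridRound a x‖) := by
        gcongr
        simpa using norm_add_le (gridRound a x) (x - gridRound a x)
    _ ≤ 2 * (√A * (chainConst p * (A * P))) + A * P := by
        rw [mul_add]
        refine add_le_add (by linarith) (le_trans ?_ hmesh)
        gcongr
        exact norm_sub_gridRound_le (by linarith) hp2.le hx ha0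
    _ = (2 * √A * chainConst p + 1) * (A * P) := by ring

end Chaining

section SequenceNorms

variable {ι : Type*} [Fintype ι] {E : ι → Type*} [∀ i, SeminormedAddCommGroup (E i)]

theorem norm_toLp_rpow {p : ℝ≥0∞} (hp : 0 < p.toReal) (x : ∀ i, E i) :
    ‖WithLp.toLp p x‖ ^ p.toReal = ∑ i, ‖x i‖ ^ p.toReal := by
  rw [PiLp.norm_eq_sum hp, ← Real.rpow_mul (Finset.sum_nonneg fun _ _ => by positivity),
    one_div_mul_cancel hp.ne', Real.rpow_one]

theorem norm_toLp_le_norm_toLp {p q : ℝ≥0∞} (hp : 1 ≤ p) (hpq : p ≤ q) (x : ∀ i, E i) :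
    ‖WithLp.toLp q x‖ ≤ ‖WithLp.toLp p x‖ := by
  have : Fact (1 ≤ p) := ⟨hp⟩
  have : Fact (1 ≤ q) := ⟨hp.trans hpq⟩
  set t := ‖WithLp.toLp p x‖ with ht
  have ht0 : 0 ≤ t := norm_nonneg _
  have hcoord : ∀ i, ‖x i‖ ≤ t := PiLp.norm_apply_le (WithLp.toLp p x)
  rcases eq_or_ne q ∞ with rfl | hq
  · rw [PiLp.norm_eq_ciSup]
    exact Real.iSup_le hcoord ht0
  have hP : 0 < p.toReal :=
    ENNReal.toReal_pos (zero_lt_one.trans_le hp).ne' (ne_top_of_le_ne_top hq hpq)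
  have hPQ : p.toReal ≤ q.toReal := ENNReal.toReal_mono hq hpq
  have hQ : 0 < q.toReal := hP.trans_le hPQ
  rw [← Real.rpow_le_rpow_iff (norm_nonneg _) ht0 hQ, norm_toLp_rpow hQ]
  calc ∑ i, ‖x i‖ ^ q.toReal ≤ ∑ i, t ^ (q.toReal - p.toReal) * ‖x i‖ ^ p.toReal := by
        refine Finset.sum_le_sum fun i _ => ?_
        rw [← sub_add_cancel q.toReal p.toReal,
          Real.rpow_add_of_nonneg (norm_nonneg _) (by linarith) hP.le, sub_add_cancel]
        gcongr
        exact hcoord i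
    _ = t ^ (q.toReal - p.toReal) * t ^ p.toReal := by
        rw [← Finset.mul_sum, ht, norm_toLp_rpow hP]
    _ = t ^ q.toReal := by
        rw [← Real.rpow_add_of_nonneg ht0 (by linarith) hP.le, sub_add_cancel]

theorem norm_toLp_le_card_rpow_mul_norm_toLp_two {p : ℝ≥0∞} (hp : 1 ≤ p) (hp2 : p ≤ 2)
    (x : ∀ i, E i) : ‖WithLp.toLp p x‖ ≤
      (Fintype.card ι : ℝ) ^ (1 / p.toReal - 1 / 2) * ‖WithLp.toLp 2 x‖ := by
  have : Fact (1 ≤ p) := ⟨hp⟩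
  have hp' : p ≠ ∞ := ne_top_of_le_ne_top ENNReal.ofNat_ne_top hp2
  have hP : 0 < p.toReal := ENNReal.toReal_pos (zero_lt_one.trans_le hp).ne' hp'
  have hP2 : p.toReal ≤ 2 := ENNReal.toReal_mono ENNReal.ofNat_ne_top hp2
  have hpowerMean := Real.rpow_sum_le_const_mul_sum_rpow_of_nonneg Finset.univ
    (f := fun i => ‖x i‖ ^ p.toReal) ((one_le_div hP).2 hP2) (fun _ _ => by positivity)
  have hexp : (1 / p.toReal - 1 / 2) * (2 : ℕ) = 2 / p.toReal - 1 := by push_cast; ring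
  refine (abs_le_of_sq_le_sq' ?_ (by positivity)).2
  rw [mul_pow, ← Real.rpow_natCast ((Fintype.card ι : ℝ) ^ _), ← Real.rpow_mul (by positivity),
    hexp, ← Real.rpow_two ‖WithLp.toLp 2 x‖, ← ENNReal.toReal_ofNat 2, norm_toLp_rpow (by simp)]
  rw [← norm_toLp_rpow hP, ← Real.rpow_mul (norm_nonneg _), mul_div_cancel₀ _ hP.ne',
    Real.rpow_two, Finset.card_univ] at hpowerMean
  simpa only [← Real.rpow_mul (norm_nonneg _), mul_div_cancel₀ _ hP.ne', ENNReal.toReal_ofNat]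
    using hpowerMean

theorem sum_two_mul_abs_inv_smul_rpow {p : ℝ≥0∞} [Fact (1 ≤ p)] (hp : 0 < p.toReal)
    {x : EuclideanSpace ℝ ι} (hx : ‖WithLp.toLp p (WithLp.ofLp x)‖ ≠ 0) :
    ∑ i, (2 * |((2 * ‖WithLp.toLp p (WithLp.ofLp x)‖)⁻¹ • x) i|) ^ p.toReal = 1 := by
  set t := ‖WithLp.toLp p (WithLp.ofLp x)‖ with ht
  have htpos : 0 < t := (norm_nonneg _).lt_of_ne' hx
  calc ∑ i, (2 * |((2 * t)⁻¹ • x) i|) ^ p.toReal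
      = ∑ i, ‖WithLp.ofLp x i‖ ^ p.toReal / t ^ p.toReal := by
        refine Finset.sum_congr rfl fun i _ => ?_
        rw [← Real.div_rpow (norm_nonneg _) htpos.le, PiLp.smul_apply, smul_eq_mul, abs_mul,
          abs_of_pos (by positivity), Real.norm_eq_abs]
        congr 1
        field_simp
    _ = 1 := by
        rw [← Finset.sum_div, ← norm_toLp_rpow hp, ← ht, div_self (by positivity)]

end SequenceNorms

theorem mem_smul_lpUnitBall {N : ℕ} {p : ℝ≥0∞} (hp : 1 ≤ p) {c : ℝ} (hc : 0 < c)
    {x : Fin N → ℝ} : x ∈ c • lpUnitBall N p ↔ ‖WithLp.toLp p x‖ ≤ c := by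
  have : Fact (1 ≤ p) := ⟨hp⟩
  rw [Set.mem_smul_set_iff_inv_smul_mem₀ hc.ne', lpUnitBall, Set.mem_ofPred_eq, WithLp.toLp_smul,
    norm_smul, Real.norm_of_nonneg (by positivity), inv_mul_le_iff₀ hc, mul_one]

theorem mem_ballsInter {J : Type*} {N : ℕ} {q : ℝ≥0∞} {p : J → ℝ≥0∞} {ν : J → ℝ}
    (hp : ∀ j, 1 ≤ p j) (hν : ∀ j, 0 < ν j) {x : PiLp q fun _ : Fin N => ℝ} :
    x ∈ ballsInter N q p ν ↔ ∀ j, ‖WithLp.toLp (p j) (WithLp.ofLp x)‖ ≤ ν j := by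
  rw [ballsInter, Set.mem_ofPred_eq, Set.mem_iInter]
  exact forall_congr' fun j => mem_smul_lpUnitBall (hp j) (hν j)

section KernelWidth

universe u v

theorem exists_linearMap_norm_le_of_map_eq_zero {p : ℝ≥0∞} (hp : 1 < p) (hp2 : p < 2) :
    ∃ D : ℝ, 0 < D ∧ ∀ (ι : Type u) (κ : Type v) [Fintype ι] [Fintype κ],
      0 < Fintype.card κ → Fintype.card κ ≤ Fintype.card ι →
      ∃ Λ : EuclideanSpace ℝ ι →ₗ[ℝ] EuclideanSpace ℝ κ, ∀ x, Λ x = 0 →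
        √(Fintype.card κ) * ‖x‖ ≤
          D * (Fintype.card ι : ℝ) ^ (1 - 1 / p.toReal) * ‖WithLp.toLp p (WithLp.ofLp x)‖ := by
  have : Fact (1 ≤ p) := ⟨hp.le⟩
  have hp' : p ≠ ∞ := (hp2.trans ENNReal.ofNat_lt_top).ne
  have hP : 1 < p.toReal := (ENNReal.toReal_lt_toReal ENNReal.one_ne_top hp').2 hp
  have hP2 : p.toReal < 2 := (ENNReal.toReal_lt_toReal hp' ENNReal.ofNat_ne_top).2 hp2
  have hP0 : 0 < p.toReal := by linarith
  have hθ : 0 < 1 - 1 / p.toReal := sub_pos.2 ((div_lt_one hP0).2 hP)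
  set A : ℝ := 4 * (5 + 1 / (1 - 1 / p.toReal))
  have hA1 : 1 ≤ A := by linarith [one_div_pos.2 hθ]
  have hchain := chainConst_nonneg hP hP2
  refine ⟨2 * ((2 * √A * chainConst p.toReal + 1) * A), by positivity,
    fun ι κ _ _ hκ hκι => ?_⟩
  obtain ⟨Λ, hΛ⟩ := exists_isLatticeEmbedding ι κ hθ
  refine ⟨Λ, fun x hx => ?_⟩
  set t := ‖WithLp.toLp p (WithLp.ofLp x)‖ with ht
  rcases eq_or_ne t 0 with ht0 | ht0
  · have hx0 : x = 0 := by simpa [ht] using ht0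
    simp [hx0, ht0]
  have htpos : 0 < t := (norm_nonneg _).lt_of_ne' ht0
  have hnormalized := (sum_two_mul_abs_inv_smul_rpow hP0 ht0).le
  have hbound := hΛ.sqrt_card_mul_norm_le_of_map_eq_zero hA1 hP hP2 hκ hκι hnormalized
    (by rw [map_smul, hx, smul_zero])
  rw [norm_smul, Real.norm_of_nonneg (by positivity), mul_left_comm,
    inv_mul_le_iff₀ (by positivity)] at hbound
  linarith

theorem exists_strongDual_norm_le {p : ℝ≥0∞} (hp : 1 < p) (hp2 : p < 2) :
    ∃ D : ℝ, 0 < D ∧ ∀ (q : ℝ≥0∞) [Fact (1 ≤ q)] (n N : ℕ), 2 ≤ q → 0 < n → n ≤ N →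
      ∃ f : Fin n → StrongDual ℝ (PiLp q fun _ : Fin N => ℝ), ∀ x, (∀ k, f k x = 0) →
        √n * ‖x‖ ≤ D * (N : ℝ) ^ (1 - 1 / p.toReal) * ‖WithLp.toLp p (WithLp.ofLp x)‖ := by
  obtain ⟨D, hD, hΛ⟩ := exists_linearMap_norm_le_of_map_eq_zero.{0, 0} hp hp2
  refine ⟨D, hD, fun q _ n N hq hn hnN => ?_⟩
  obtain ⟨Λ, hΛ⟩ := hΛ (Fin N) (Fin n) (by simpa using hn) (by simpa using hnN)
  simp only [Fintype.card_fin] at hΛ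
  let toEuclidean := (WithLp.linearEquiv q ℝ (Fin N → ℝ)).trans
    (WithLp.linearEquiv 2 ℝ (Fin N → ℝ)).symm
  refine ⟨fun k => LinearMap.toContinuousLinearMap
    (PiLp.projₗ 2 (fun _ : Fin n => ℝ) k ∘ₗ Λ ∘ₗ toEuclidean.toLinearMap), fun x hx => ?_⟩
  have hker : Λ (toEuclidean x) = 0 := by
    ext k
    simpa using hx k
  have hcoords : WithLp.ofLp (toEuclidean x) = WithLp.ofLp x := rfl
  calc √n * ‖x‖ ≤ √n * ‖toEuclidean x‖ :=
        mul_le_mul_of_nonneg_left (norm_toLp_le_norm_toLp one_le_two hq (WithLp.ofLp x))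
          (Real.sqrt_nonneg _)
    _ ≤ _ := hcoords ▸ hΛ _ hker

end KernelWidth

section SpreadVector

variable {ι : Type*} [Fintype ι] [DecidableEq ι] (U : Submodule ℝ (EuclideanSpace ℝ ι))

theorem norm_starProjection_single_sq (i : ι) :
    ‖U.starProjection (EuclideanSpace.single i 1)‖ ^ 2 =
      U.starProjection (EuclideanSpace.single i 1) i := by
  have h := U.re_inner_starProjection_eq_normSq (EuclideanSpace.single i (1 : ℝ))
  rw [EuclideanSpace.inner_single_right] at h
  simpa using h.symm

theorem sum_starProjection_single :
    ∑ i, U.starProjection (EuclideanSpace.single i (1 : ℝ)) i = Module.finrank ℝ U := by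
  have hproj : LinearMap.IsProj U (U.starProjection : _ →ₗ[ℝ] EuclideanSpace ℝ ι) :=
    ⟨fun x => U.starProjection_apply_mem x, fun x hx => Submodule.starProjection_eq_self_iff.2 hx⟩
  rw [← hproj.trace, LinearMap.trace_eq_sum_inner _ (EuclideanSpace.basisFun ι ℝ)]
  simp [EuclideanSpace.inner_single_left]

theorem norm_single_sub_starProjection_sq (i : ι) :
    ‖EuclideanSpace.single i 1 - U.starProjection (EuclideanSpace.single i 1)‖ ^ 2 =
      1 - U.starProjection (EuclideanSpace.single i 1) i := by
  rw [norm_sub_sq_real, norm_starProjection_single_sq, EuclideanSpace.inner_single_left,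
    PiLp.norm_single, norm_one, map_one]
  ring

theorem exists_one_sub_starProjection_single_le [Nonempty ι] {n : ℕ}
    (hU : Fintype.card ι ≤ Module.finrank ℝ U + n) :
    ∃ i, 1 - U.starProjection (EuclideanSpace.single i 1) i ≤ n / Fintype.card ι := by
  obtain ⟨i, -, hi⟩ := Finset.exists_le_of_sum_le
    (f := fun i => 1 - U.starProjection (EuclideanSpace.single i (1 : ℝ)) i)
    (g := fun _ => (n : ℝ) / Fintype.card ι) Finset.univ_nonempty (by
      have hU' : (Fintype.card ι : ℝ) ≤ Module.finrank ℝ U + n := by exact_mod_cast hU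
      rw [Finset.sum_sub_distrib, sum_starProjection_single, Finset.sum_const, Finset.sum_const,
        Finset.card_univ, nsmul_one, nsmul_eq_mul, mul_div_cancel₀ _ (by simp)]
      linarith)
  exact ⟨i, hi⟩

end SpreadVector

theorem exists_mem_norm_toLp_le {ι : Type*} [Fintype ι] [Nonempty ι]
    (U : Submodule ℝ (EuclideanSpace ℝ ι)) {n : ℕ}
    (hU : Fintype.card ι ≤ Module.finrank ℝ U + n) (hn : (n : ℝ) ≤ Fintype.card ι / 2) :
    ∃ x ∈ U, (∃ i, 1 / 2 ≤ x i) ∧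
      (∀ p : ℝ≥0∞, 2 ≤ p → ‖WithLp.toLp p (WithLp.ofLp x)‖ ≤ 1) ∧
      ∀ p : ℝ≥0∞, 1 ≤ p → p ≤ 2 → ‖WithLp.toLp p (WithLp.ofLp x)‖ ≤
        1 + (Fintype.card ι : ℝ) ^ (1 / p.toReal - 1) * √n := by
  classical
  have hN : (0 : ℝ) < Fintype.card ι := by exact_mod_cast Fintype.card_pos
  obtain ⟨i, hi⟩ := exists_one_sub_starProjection_single_le U hU
  set e : EuclideanSpace ℝ ι := EuclideanSpace.single i 1 with he
  have hdist : ‖e - U.starProjection e‖ ≤ √n / √(Fintype.card ι) := by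
    rw [← Real.sqrt_div (Nat.cast_nonneg n)]
    exact Real.le_sqrt_of_sq_le ((norm_single_sub_starProjection_sq U i).trans_le hi)
  refine ⟨U.starProjection e, U.starProjection_apply_mem e, ⟨i, ?_⟩, fun p hp => ?_,
    fun p hp hp2 => ?_⟩
  · have : (n : ℝ) / Fintype.card ι ≤ 1 / 2 := by
      rw [div_le_iff₀ hN]
      linarith
    linarith
  · calc _ ≤ ‖U.starProjection e‖ := norm_toLp_le_norm_toLp one_le_two hp _
      _ ≤ ‖e‖ := U.norm_starProjection_apply_le e
      _ = 1 := by simp [he]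
  · have : Fact (1 ≤ p) := ⟨hp⟩
    have hone : ‖WithLp.toLp p (WithLp.ofLp e)‖ = 1 := by
      simp [he, PiLp.norm_single]
    have hexp : (Fintype.card ι : ℝ) ^ (1 / p.toReal - 1 / 2) =
        (Fintype.card ι : ℝ) ^ (1 / p.toReal - 1) * √(Fintype.card ι) := by
      rw [Real.sqrt_eq_rpow, ← Real.rpow_add hN]
      congr 1
      ring
    calc ‖WithLp.toLp p (WithLp.ofLp (U.starProjection e))‖
        ≤ ‖WithLp.toLp p (WithLp.ofLp e)‖ +
            ‖WithLp.toLp p (WithLp.ofLp (e - U.starProjection e))‖ := by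
          rw [WithLp.ofLp_sub, WithLp.toLp_sub]
          exact norm_le_insert _ _
      _ ≤ 1 + (Fintype.card ι : ℝ) ^ (1 / p.toReal - 1 / 2) * (√n / √(Fintype.card ι)) := by
          rw [hone]
          gcongr
          exact (norm_toLp_le_card_rpow_mul_norm_toLp_two hp hp2 _).trans (by gcongr)
      _ = 1 + (Fintype.card ι : ℝ) ^ (1 / p.toReal - 1) * √n := by
          rw [hexp]
          field_simp

section GelfandWidth

theorem gelfandWidth_le {X : Type*} [NormedAddCommGroup X] [NormedSpace ℝ X] {n : ℕ}
    {M : Set X} {R : ℝ} (f : Fin n → StrongDual ℝ X)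
    (h : ∀ x ∈ M, (∀ k, f k x = 0) → ‖x‖ ≤ R) : gelfandWidth n M ≤ ENNReal.ofReal R := by
  refine (iInf_le _ f).trans (iSup₂_le fun x hx => ?_)
  rw [← ofReal_norm]
  exact ENNReal.ofReal_le_ofReal (h x hx.1 hx.2)

theorem le_gelfandWidth {X : Type*} [NormedAddCommGroup X] [NormedSpace ℝ X] {n : ℕ}
    {M : Set X} {R : ℝ}
    (h : ∀ f : Fin n → StrongDual ℝ X, ∃ x ∈ M, (∀ k, f k x = 0) ∧ R ≤ ‖x‖) :
    ENNReal.ofReal R ≤ gelfandWidth n M := by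
  refine le_iInf fun f => ?_
  obtain ⟨x, hxM, hxf, hx⟩ := h f
  refine le_iSup₂_of_le x ⟨hxM, hxf⟩ ?_
  rw [← ofReal_norm]
  exact ENNReal.ofReal_le_ofReal hx

variable {J : Type*} {q : ℝ≥0∞} [Fact (1 ≤ q)] {N n : ℕ} {p : J → ℝ≥0∞} {ν : J → ℝ}

theorem le_gelfandWidth_ballsInter (hp : ∀ j, 1 ≤ p j) (hν : ∀ j, 0 < ν j) (hN : 0 < N)
    (hn : (n : ℝ) ≤ N / 2) {R : ℝ} (hR : 0 ≤ R) (hRν : ∀ j, R ≤ ν j)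
    (hRn : ∀ j, R * √n ≤ ν j * (N : ℝ) ^ (1 - 1 / (p j).toReal)) :
    ENNReal.ofReal (R / 4) ≤ gelfandWidth n (ballsInter N q p ν) := by
  have hN0 : (0 : ℝ) < N := Nat.cast_pos.2 hN
  have hR2 : 0 ≤ R / 2 := by positivity
  have : Nonempty (Fin N) := ⟨⟨0, hN⟩⟩
  refine le_gelfandWidth fun f => ?_
  let φ : EuclideanSpace ℝ (Fin N) →ₗ[ℝ] (Fin n → ℝ) :=
    (LinearMap.pi fun k => (f k).toLinearMap) ∘ₗ
      (WithLp.linearEquiv q ℝ (Fin N → ℝ)).symm.toLinearMap ∘ₗ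
      (WithLp.linearEquiv 2 ℝ (Fin N → ℝ)).toLinearMap
  have hrank : Fintype.card (Fin N) ≤ Module.finrank ℝ (LinearMap.ker φ) + n := by
    have hker := LinearMap.finrank_range_add_finrank_ker φ
    have hrange : Module.finrank ℝ (LinearMap.range φ) ≤ n := by
      simpa using Submodule.finrank_le (LinearMap.range φ)
    rw [finrank_euclideanSpace] at hker
    omega
  obtain ⟨x, hxφ, ⟨i, hxi⟩, hx2, hx1⟩ := exists_mem_norm_toLp_le _ hrank (by simpa using hn)
  rw [Fintype.card_fin] at hx1
  have hxf : ∀ k, f k (WithLp.toLp q (WithLp.ofLp x)) = 0 := congrFun (LinearMap.mem_ker.1 hxφ)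
  refine ⟨(R / 2) • WithLp.toLp q (WithLp.ofLp x), (mem_ballsInter hp hν).2 fun j => ?_,
    fun k => by rw [map_smul, hxf, smul_zero], ?_⟩
  · have : Fact (1 ≤ p j) := ⟨hp j⟩
    rw [WithLp.ofLp_smul, WithLp.toLp_smul, norm_smul, Real.norm_of_nonneg (by positivity)]
    rcases le_total 2 (p j) with h | h
    · linarith [hRν j, mul_le_of_le_one_right hR2 (hx2 _ h)]
    · have hscale : R * ((N : ℝ) ^ (1 / (p j).toReal - 1) * √n) ≤ ν j := by
        have hpos : (0 : ℝ) < (N : ℝ) ^ (1 - 1 / (p j).toReal) := by positivity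
        rw [← neg_sub 1 (1 / (p j).toReal), Real.rpow_neg hN0.le, mul_left_comm,
          inv_mul_le_iff₀ hpos, mul_comm _ (ν j)]
        exact hRn j
      linarith [hRν j, mul_le_mul_of_nonneg_left (hx1 _ (hp j) h) hR2]
  · have hcoord : x i ≤ ‖WithLp.toLp q (WithLp.ofLp x)‖ :=
      (le_abs_self _).trans (PiLp.norm_apply_le (WithLp.toLp q (WithLp.ofLp x)) i)
    rw [norm_smul, Real.norm_of_nonneg (by positivity)]
    linarith [mul_le_mul_of_nonneg_left (hxi.trans hcoord) hR2]

end GelfandWidth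

section WidthRate

theorem toReal_one_div_conjExponent {p : ℝ≥0∞} (hp : 1 ≤ p) :
    (1 / ENNReal.conjExponent p).toReal = 1 - 1 / p.toReal := by
  have hsum := (ENNReal.HolderConjugate.conjExponent hp).inv_add_inv_eq_one
  have hp_inv : p⁻¹ ≤ 1 := ENNReal.inv_le_one.2 hp
  have hconj : (ENNReal.conjExponent p)⁻¹ = 1 - p⁻¹ :=
    ENNReal.eq_sub_of_add_eq (ne_top_of_le_ne_top ENNReal.one_ne_top hp_inv)
      ((add_comm _ _).trans hsum)
  rw [one_div, hconj, ENNReal.toReal_sub_of_le hp_inv ENNReal.one_ne_top, ENNReal.toReal_inv,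
    ENNReal.toReal_one, one_div]

variable {N : ℕ} {p : ℝ≥0∞} {ν : ℝ}

theorem widthRate_zero (hN : 0 < N) (hν : 0 < ν) (ν' : ℝ) :
    widthRate 0 N p ν ν' = ENNReal.ofReal ν' := by
  have hν' : ENNReal.ofReal ν ≠ 0 := by simpa using hν
  have hNpow : (N : ℝ≥0∞) ^ (1 / ENNReal.conjExponent p).toReal ≠ 0 := by
    simp [ENNReal.rpow_eq_zero_iff, hN.ne']
  rw [widthRate, Nat.cast_zero, ENNReal.zero_rpow_of_neg (by norm_num), ENNReal.mul_top hν',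
    ENNReal.top_mul hNpow, min_eq_right le_top]

theorem widthRate_of_pos {n : ℕ} (hn : 0 < n) (hN : 0 < N) (hp : 1 ≤ p) (hν : 0 ≤ ν) (ν' : ℝ) :
    widthRate n N p ν ν' =
      ENNReal.ofReal (min (ν * (N : ℝ) ^ (1 - 1 / p.toReal) / √n) ν') := by
  have hn0 : (0 : ℝ) < n := Nat.cast_pos.2 hn
  have hN0 : (0 : ℝ) < N := Nat.cast_pos.2 hN
  rw [widthRate, toReal_one_div_conjExponent hp, ENNReal.ofReal_min, ← ENNReal.ofReal_natCast n,
    ← ENNReal.ofReal_natCast N, ENNReal.ofReal_rpow_of_pos hn0, ENNReal.ofReal_rpow_of_pos hN0,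
    ← ENNReal.ofReal_mul hν, ← ENNReal.ofReal_mul (by positivity), Real.rpow_neg hn0.le,
    ← Real.sqrt_eq_rpow, ← div_eq_mul_inv, div_mul_eq_mul_div]

theorem exists_widthRate_eq_ofReal {n : ℕ} (hN : 0 < N) (hp : 1 ≤ p) (hν : 0 < ν) {ν' : ℝ}
    (hν' : 0 < ν') :
    ∃ R, 0 < R ∧ widthRate n N p ν ν' = ENNReal.ofReal R ∧ R ≤ ν' ∧
      R * √n ≤ ν * (N : ℝ) ^ (1 - 1 / p.toReal) ∧
      (R = ν' ∨ 0 < n ∧ R = ν * (N : ℝ) ^ (1 - 1 / p.toReal) / √n) := by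
  have hN0 : (0 : ℝ) < N := Nat.cast_pos.2 hN
  rcases Nat.eq_zero_or_pos n with rfl | hn
  · refine ⟨ν', hν', widthRate_zero hN hν ν', le_rfl, ?_, Or.inl rfl⟩
    rw [Nat.cast_zero, Real.sqrt_zero, mul_zero]
    positivity
  · have hsqrt : 0 < √(n : ℝ) := Real.sqrt_pos.2 (Nat.cast_pos.2 hn)
    refine ⟨_, lt_min (by positivity) hν', widthRate_of_pos hn hN hp hν.le ν', min_le_right _ _,
      (le_div_iff₀ hsqrt).1 (min_le_left _ _), ?_⟩
    exact (min_choice _ _).symm.imp id fun h => ⟨hn, h⟩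

end WidthRate

theorem rpow_one_sub_one_div_toReal {x : ℝ} (hx : 0 < x) (p : ℝ≥0∞) :
    x ^ (1 - 1 / p.toReal) = x * x ^ (-(1 / p).toReal) := by
  rw [ENNReal.toReal_div, ENNReal.toReal_one, sub_eq_add_neg, Real.rpow_add hx, Real.rpow_one]

theorem exists_gelfandWidth_ballsInter_le {p₁ : ℝ≥0∞} (hp₁ : 1 < p₁) (hp₁' : p₁ < 2) :
    ∃ D : ℝ, 0 < D ∧ ∀ {J : Type*} (q : ℝ≥0∞) [Fact (1 ≤ q)] (N n : ℕ) (p : J → ℝ≥0∞)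
      (ν : J → ℝ) (a : J), 2 ≤ q → p a = p₁ → (∀ j, 1 ≤ p j) → (∀ j, 0 < ν j) → 0 < n → n ≤ N →
        gelfandWidth n (ballsInter N q p ν) ≤
          ENNReal.ofReal (D * (ν a * (N : ℝ) ^ (1 - 1 / p₁.toReal) / √n)) := by
  obtain ⟨D, hD, hf⟩ := exists_strongDual_norm_le hp₁ hp₁'
  refine ⟨D, hD, fun q _ N n p ν a hq ha hp hν hn hnN => ?_⟩
  obtain ⟨f, hf⟩ := hf q n N hq hn hnN
  refine gelfandWidth_le f fun x hx hxf => ?_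
  have hxa := ha ▸ (mem_ballsInter hp hν).1 hx a
  rw [← mul_div_assoc, le_div_iff₀' (Real.sqrt_pos.2 (Nat.cast_pos.2 hn))]
  calc √n * ‖x‖ ≤ D * (N : ℝ) ^ (1 - 1 / p₁.toReal) * ‖WithLp.toLp p₁ (WithLp.ofLp x)‖ := hf x hxf
    _ ≤ D * (N : ℝ) ^ (1 - 1 / p₁.toReal) * ν a := by gcongr
    _ = D * (ν a * (N : ℝ) ^ (1 - 1 / p₁.toReal)) := by ring

theorem gelfandWidth_ballsInter_le_ofReal {J : Type*} {q : ℝ≥0∞} [Fact (1 ≤ q)] {N n : ℕ}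
    {p : J → ℝ≥0∞} {ν : J → ℝ} (hp : ∀ j, 1 ≤ p j) (hν : ∀ j, 0 < ν j) {b : J} (hb : p b ≤ q) :
    gelfandWidth n (ballsInter N q p ν) ≤ ENNReal.ofReal (ν b) :=
  gelfandWidth_le 0 fun x hx _ =>
    (norm_toLp_le_norm_toLp (hp b) hb (WithLp.ofLp x)).trans ((mem_ballsInter hp hν).1 hx b)

theorem theorem1_general (p₁ : ℝ≥0∞) (hp₁ : 1 < p₁) (hp₁' : p₁ < 2) :
    ∃ c C : ℝ, 0 < c ∧ 0 < C ∧
      ∀ {J : Type*} (q : ℝ≥0∞) [Fact (1 ≤ q)] (N n : ℕ) (p : J → ℝ≥0∞) (ν : J → ℝ) (a b : J),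
        2 ≤ q → p a = p₁ → p b ≤ q → (∀ j, 1 ≤ p j) → (∀ j, 0 < ν j) → (∀ j, ν b ≤ ν j) →
        (∀ j, ν a * (N : ℝ) ^ (-(1 / p a).toReal) ≤ ν j * (N : ℝ) ^ (-(1 / p j).toReal)) →
        0 < N → (n : ℝ) ≤ N / 2 →
          ENNReal.ofReal c * widthRate n N p₁ (ν a) (ν b) ≤ gelfandWidth n (ballsInter N q p ν) ∧
          gelfandWidth n (ballsInter N q p ν) ≤
            ENNReal.ofReal C * widthRate n N p₁ (ν a) (ν b) := by
  obtain ⟨D, hD, hupper⟩ := exists_gelfandWidth_ballsInter_le hp₁ hp₁'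
  refine ⟨1 / 4, max D 1, by norm_num, by positivity, ?_⟩
  intro J q _ N n p ν a b hq ha hb hp hν hmin hscale hN hn
  have hN0 : (0 : ℝ) < N := Nat.cast_pos.2 hN
  have hnN : n ≤ N := by exact_mod_cast (show (n : ℝ) ≤ N by linarith)
  obtain ⟨R, hR, hrate, hRb, hRa, hRcases⟩ :=
    exists_widthRate_eq_ofReal (n := n) hN hp₁.le (hν a) (hν b)
  rw [hrate, ← ENNReal.ofReal_mul (by norm_num), ← ENNReal.ofReal_mul (by positivity)]
  constructor
  · rw [one_div_mul_eq_div]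
    refine le_gelfandWidth_ballsInter hp hν hN hn hR.le (fun j => hRb.trans (hmin j)) fun j => ?_
    calc R * √n ≤ ν a * (N : ℝ) ^ (1 - 1 / p₁.toReal) := hRa
      _ = N * (ν a * (N : ℝ) ^ (-(1 / p a).toReal)) := by
        rw [ha, rpow_one_sub_one_div_toReal hN0, mul_left_comm]
      _ ≤ N * (ν j * (N : ℝ) ^ (-(1 / p j).toReal)) :=
        mul_le_mul_of_nonneg_left (hscale j) hN0.le
      _ = ν j * (N : ℝ) ^ (1 - 1 / (p j).toReal) := by
        rw [rpow_one_sub_one_div_toReal hN0, mul_left_comm]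
  · rcases hRcases with rfl | ⟨hn0, rfl⟩
    · refine (gelfandWidth_ballsInter_le_ofReal hp hν hb).trans (ENNReal.ofReal_le_ofReal ?_)
      exact le_mul_of_one_le_left hR.le (le_max_right _ _)
    · refine (hupper q N n p ν a hq ha hp hν hn0 hnN).trans (ENNReal.ofReal_le_ofReal ?_)
      exact mul_le_mul_of_nonneg_right (le_max_left _ _) hR.le

/-- The balls are indexed by `Fin (r + 1)`, so `p 0`, `ν 0` belong to the first ball and
`p (Fin.last r)`, `ν (Fin.last r)` to the last one. The constants depend on `p₁` only. -/
theorem theorem1 (p₁ : ℝ≥0∞) (hp₁ : 1 < p₁) (hp₁' : p₁ < 2) :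
    ∃ c C : ℝ, 0 < c ∧ 0 < C ∧
      ∀ (q : ℝ≥0∞) [Fact (1 ≤ q)] (r N n : ℕ) (p : Fin (r + 1) → ℝ≥0∞) (ν : Fin (r + 1) → ℝ),
        2 ≤ q →
        p 0 = p₁ → Monotone p → p (Fin.last r) ≤ q →
        (∀ j, 0 < ν j) → Antitone ν →
        Monotone (fun j => ν j * (N : ℝ) ^ (-(1 / p j).toReal)) →
        0 < N → (n : ℝ) ≤ (N : ℝ) / 2 →
          ENNReal.ofReal c * widthRate n N p₁ (ν 0) (ν (Fin.last r))
              ≤ gelfandWidth n (ballsInter N q p ν) ∧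
          gelfandWidth n (ballsInter N q p ν)
              ≤ ENNReal.ofReal C * widthRate n N p₁ (ν 0) (ν (Fin.last r)) := by
  obtain ⟨c, C, hc, hC, h⟩ := theorem1_general p₁ hp₁ hp₁'
  refine ⟨c, C, hc, hC, fun q _ r N n p ν hq hp0 hp hpq hν hνanti hscale hN hn => ?_⟩
  exact h q N n p ν 0 (Fin.last r) hq hp0 hpq
    (fun j => hp₁.le.trans (hp0 ▸ hp (Fin.zero_le j))) hν (fun j => hνanti (Fin.le_last j))
    (fun j => hscale (Fin.zero_le j)) hN hn
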